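/- Let $n\ge 1$ workers $i\in[n]$ have data distributions $\mathcal D_i$ and sample losses $f_i(x;\xi)$, $x\in\mathbb R^d$, and let $f_i(x)=\mathbb E_{\xi\sim\mathcal D_i}[f_i(x;\xi)]$ and $f=\frac1n\sum_{i=1}^n f_i$. Assume: (1) each $f_i(\cdot;\xi)$ is differentiable for every $\xi$, and for all $i$ and $x$, $\mathbb E_{\xi\sim\mathcal D_i}[\nabla f_i(x;\xi)]=\nabla f_i(x)$ and $\mathbb E_{\xi\sim\mathcal D_i}\|\nabla f_i(x;\xi)-\nabla f_i(x)\|^2\le\sigma^2$; (2) each $f_i$ is differentiable, and for some $L>0$ one has $\big\|\nabla f(x)-\frac1n\sum_{i=1}^n\nabla f_i(y_i)\big\|^2\le\frac{L^2}{n}\sum_{i=1}^n\|x-y_i\|^2$ for all $x,y_1,\dots,y_n\in\mathbb R^d$; (3) $f(x)\ge f^*>-\infty$ for all $x$. For the starting point $x^0$ put $\Delta=f(x^0)-f^*$. Let $\varepsilon>0$. A random vector $X$ is called an $\varepsilon$-stationary point if $\mathbb E\|\nabla f(X)\|^2\le\varepsilon$. *Computation model (universal computation model).* Each worker $i$ has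 a compute power $p_i:[0,\infty)\to[0,\infty)$, continuous almost everywhere and integrable on bounded intervals. The workers compute without pausing, communication takes no time, and a worker that starts a computation at time $T^1$ and keeps computing completes $\lfloor\int_{T^1}^{T^2}p_i(t)\,dt\rfloor$ gradients by time $T^2$; thus by time $t$ exactly $\lfloor\int_0^t p_i(s)\,ds\rfloor$ gradients of worker $i$ have reached the server. Gradients that arrive simultaneously are processed in an arbitrary order. *Algorithm (Ringleader ASGD with the Malenia stopping rule, stepsize $\gamma$).* Every worker $i$ repeatedly computes $\nabla f_i(x;\xi)$ at the last model $x$ it was sent (initially $x^0$) with a fresh independent sample $\xi\sim\mathcal D_i$, and sends it to the server. The server keeps a table $(G_i,b_i)_{i\in[n]}$ of gradient sums and gradient counts, initially zero, and $k=0$, and repeats the following round. Phase 1: each received gradient $g$ of a worker $j$ is added to the table ($G_j\leftarrow G_j+g$, $b_j\leftarrow b_j+1$), until $$\Big(\frac1n\sum_{i=1}^n\frac1{b_i}\Big)^{-1}\ge\max\Big\{1,\frac{\sigma^2}{n\varepsilon}\Big\},$$ where $1/0=\infty$ and $1/\infty=0$. Phase 2: set $x^{k+1}=x^k-\gamma\frac1n\sum_{i=1}^n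 G_i/b_i$, send $x^{k+1}$ to the worker whose gradient ended Phase 1, and increase $k$ by one. Then, until every worker has been updated once in this round: a gradient received from a worker $j$ not yet updated in this round is added to the table, another step $x^{k+1}=x^k-\gamma\frac1n\sum_i G_i/b_i$ is made, $x^{k+1}$ is sent to worker $j$, and $k$ is increased by one; a gradient received from a worker already updated in this round is added to a temporary table, which is empty at the start of Phase 2. When all workers have been updated, the temporary table becomes the main table and the next round begins. **Theorem.** Let $\gamma=\frac1{10nL}$, let $K=\left\lceil\frac{160L\Delta}{\varepsilon}\right\rceil$, let $T^0=0$ and, for $k\ge1$, $$T^k=\min\left\{T\ge0:\Big(\frac1n\sum_{i=1}^n\Big\lfloor\int_{T^{k-1}}^{T}p_i(t)\,dt\Big\rfloor^{-1}\Big)^{-1}\ge\max\Big\{1,\frac{\sigma^2}{n\varepsilon}\Big\}\right\},$$ where the left-hand side counts as $0$ if one of the floors is not positive, and suppose that $T^1,\dots,T^K$ exist (i.e. the sets are nonempty). Then, under the universal computation model, the algorithm finds an $\varepsilon$-stationary point within at most $T^K$ seconds: one of the iterates that the server has formed by time $T^K$ (possibly $x^0$) is an $\varepsilon$-stationary point.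 -/

import Mathlib

noncomputable section

namespace Ringleader

open MeasureTheory ProbabilityTheory

/-! ### The optimization problem -/

/-- The model space `ℝ^d` with its Euclidean norm. -/
abbrev Vec (d : ℕ) : Type := EuclideanSpace ℝ (Fin d)

/-- The stochastic gradient `∇ f_i(x; ξ)`: the gradient of the sample loss in its first argument. -/
def stochGrad {d n : ℕ} {Ξ : Fin n → Type*} (F : ∀ i, Vec d → Ξ i → ℝ)
    (i : Fin n) (x : Vec d) (ξ : Ξ i) : Vec d :=
  gradient (fun y => F i y ξ) x

/-- The local objective `f_i(x) = E_{ξ ∼ D_i} f_i(x; ξ)` of worker `i`. -/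
def localObjective {d n : ℕ} {Ξ : Fin n → Type*} [∀ i, MeasurableSpace (Ξ i)]
    (F : ∀ i, Vec d → Ξ i → ℝ) (D : ∀ i, Measure (Ξ i)) (i : Fin n) (x : Vec d) : ℝ :=
  ∫ ξ, F i x ξ ∂(D i)

/-- The global objective `f(x) = (1/n) ∑ i, f_i(x)`. -/
def objective {d n : ℕ} {Ξ : Fin n → Type*} [∀ i, MeasurableSpace (Ξ i)]
    (F : ∀ i, Vec d → Ξ i → ℝ) (D : ∀ i, Measure (Ξ i)) (x : Vec d) : ℝ :=
  (1 / (n : ℝ)) * ∑ i, localObjective F D i x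

/-- The sample losses are differentiable random functions whose expectations are the local
objectives, and the stochastic gradients are unbiased with variance at most `σ²`. -/
structure UnbiasedBoundedVariance {d n : ℕ} {Ξ : Fin n → Type*} [∀ i, MeasurableSpace (Ξ i)]
    (F : ∀ i, Vec d → Ξ i → ℝ) (D : ∀ i, Measure (Ξ i)) (σ : ℝ) : Prop where
  measurable_loss : ∀ i x, Measurable (F i x)
  integrable_loss : ∀ i x, Integrable (F i x) (D i)
  differentiable_loss : ∀ i ξ, Differentiable ℝ (fun x => F i x ξ)
  integrable_grad : ∀ i x, Integrable (stochGrad F i x) (D i)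
  unbiased : ∀ i x, ∫ ξ, stochGrad F i x ξ ∂(D i) = gradient (localObjective F D i) x
  integrable_sq : ∀ i x,
    Integrable (fun ξ => ‖stochGrad F i x ξ - gradient (localObjective F D i) x‖ ^ 2) (D i)
  variance_le : ∀ i x,
    ∫ ξ, ‖stochGrad F i x ξ - gradient (localObjective F D i) x‖ ^ 2 ∂(D i) ≤ σ ^ 2

/-- The local objectives are differentiable and
`‖∇f(x) - (1/n) ∑ i, ∇f_i(y_i)‖² ≤ (L²/n) ∑ i, ‖x - y_i‖²` for all `x, y_1, …, y_n`. -/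
structure GeneralizedSmooth {d n : ℕ} {Ξ : Fin n → Type*} [∀ i, MeasurableSpace (Ξ i)]
    (F : ∀ i, Vec d → Ξ i → ℝ) (D : ∀ i, Measure (Ξ i)) (L : ℝ) : Prop where
  differentiable : ∀ i, Differentiable ℝ (localObjective F D i)
  smooth : ∀ (x : Vec d) (y : Fin n → Vec d),
    ‖gradient (objective F D) x - (1 / (n : ℝ)) • ∑ i, gradient (localObjective F D i) (y i)‖ ^ 2
      ≤ L ^ 2 / n * ∑ i, ‖x - y i‖ ^ 2

/-- A random vector `X` is an `ε`-stationary point of `f` if `E ‖∇f(X)‖² ≤ ε`. -/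
def IsStationaryPoint {d : ℕ} {Ω : Type*} [MeasurableSpace Ω] (μ : Measure Ω)
    (f : Vec d → ℝ) (ε : ℝ) (X : Ω → Vec d) : Prop :=
  Measurable X ∧ Integrable (fun ω => ‖gradient f (X ω)‖ ^ 2) μ ∧
    ∫ ω, ‖gradient f (X ω)‖ ^ 2 ∂μ ≤ ε

/-! ### Batch sizes and the stopping rule of Phase 1 -/

/-- The harmonic mean `((1/n) ∑ i, b_i⁻¹)⁻¹` of the batch sizes. If some `b_i` is zero then
`b_i⁻¹ = ∞`, and the harmonic mean is `0`. -/
def harmonicMean {n : ℕ} (b : Fin n → ℕ) : ℝ :=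
  open Classical in
  if ∀ i, 0 < b i then ((1 / (n : ℝ)) * ∑ i, (b i : ℝ)⁻¹)⁻¹ else 0

/-- The threshold `max {1, σ²/(nε)}`. -/
def threshold (n : ℕ) (σ ε : ℝ) : ℝ := max 1 (σ ^ 2 / (n * ε))

/-! ### The universal computation model -/

/-- A compute power function on `[0, ∞)`: nonnegative, continuous almost everywhere, and with a
finite integral over every bounded interval. Values at negative times are irrelevant. -/
structure IsComputePower (p : ℝ → ℝ) : Prop where
  nonneg : ∀ t, 0 ≤ t → 0 ≤ p t
  continuous_ae : ∀ᵐ t ∂(volume.restrict (Set.Ici (0 : ℝ))), ContinuousAt p t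
  integrable : ∀ t, 0 ≤ t → IntervalIntegrable p volume 0 t

/-- The sequence of all gradients that arrive at the server, in chronological order: arrival
number `q` comes from worker `worker q` at time `time q`. Workers compute without ever pausing,
and communication is instantaneous, so by time `t` exactly `⌊∫₀ᵗ p_i⌋` gradients of worker `i`
have arrived. Simultaneous arrivals are handled in any order. If only finitely many gradients
are ever completed, the remaining entries have time `∞`, i.e. they never arrive. -/
structure Arrivals {n : ℕ} (p : Fin n → ℝ → ℝ) where
  worker : ℕ → Fin n
  time : ℕ → ENNReal
  chronological : Monotone time
  count : ∀ (i : Fin n) (t : ℝ), 0 ≤ t →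
    {q : ℕ | worker q = i ∧ time q ≤ ENNReal.ofReal t}.encard =
      ((⌊∫ s in (0 : ℝ)..t, p i s⌋₊ : ℕ) : ℕ∞)

/-- `T 0, …, T K` are the times defined by `T 0 = 0` and
`T (k+1) = min {t ≥ 0 : ((1/n) ∑ i, ⌊∫_{T k}^t p_i⌋⁻¹)⁻¹ ≥ max {1, σ²/(nε)}}`.
For `t < T k` the integrals are nonpositive and the counts `⌊·⌋₊` are zero. -/
def IsTimeSequence {n : ℕ} (p : Fin n → ℝ → ℝ) (σ ε : ℝ) (K : ℕ) (T : ℕ → ℝ) : Prop :=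
  T 0 = 0 ∧ ∀ k < K,
    IsLeast {t : ℝ | 0 ≤ t ∧
      threshold n σ ε ≤ harmonicMean (fun i => ⌊∫ s in (T k)..t, p i s⌋₊)} (T (k + 1))

/-! ### The algorithm -/

/-- The two phases of a round. -/
inductive Phase
  | collect
  | update

/-- The joint state of the server and the workers. -/
structure State (d n : ℕ) where
  /-- the phase that the server is in -/
  phase : Phase
  /-- the iteration counter `k` -/
  k : ℕ
  /-- the current iterate `x^k` -/
  x : Vec d
  /-- the gradient table: sums of gradients -/
  G : Fin n → Vec d
  /-- the gradient table: batch sizes -/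
  b : Fin n → ℕ
  /-- Phase 1: workers with an entry in the table; Phase 2: workers still to be updated -/
  S : Finset (Fin n)
  /-- the temporary table: sums of gradients -/
  Gplus : Fin n → Vec d
  /-- the temporary table: batch sizes -/
  bplus : Fin n → ℕ
  /-- workers with an entry in the temporary table -/
  Splus : Finset (Fin n)
  /-- the model that each worker currently computes gradients at -/
  model : Fin n → Vec d
  /-- the number of gradients that each worker has completed -/
  done : Fin n → ℕ

/-- Initialization: every worker holds `x⁰` and all tables are empty. -/
def State.init {d n : ℕ} (x₀ : Vec d) : State d n where
  phase := .collect
  k := 0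
  x := x₀
  G := 0
  b := 0
  S := ∅
  Gplus := 0
  bplus := 0
  Splus := ∅
  model := fun _ => x₀
  done := 0

/-- Add the gradient `g` of worker `j` to the main table. -/
def State.addToTable {d n : ℕ} (s : State d n) (j : Fin n) (g : Vec d) : State d n :=
  { s with
    G := Function.update s.G j (s.G j + g)
    b := Function.update s.b j (s.b j + 1) }

/-- Add the gradient `g` of worker `j` to the temporary table, for the next round. -/
def State.buffer {d n : ℕ} (s : State d n) (j : Fin n) (g : Vec d) : State d n :=
  { s with
    Gplus := Function.update s.Gplus j (s.Gplus j + g)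
    bplus := Function.update s.bplus j (s.bplus j + 1)
    Splus := insert j s.Splus }

/-- The update `x^{k+1} = x^k - γ (1/n) ∑ i, G_i / b_i`, after which `x^{k+1}` is sent to worker
`j`, the counter is increased, and `j` is removed from `S`. -/
def State.descend {d n : ℕ} (γ : ℝ) (s : State d n) (j : Fin n) : State d n :=
  let x' := s.x - γ • ((1 / (n : ℝ)) • ∑ i, ((s.b i : ℝ)⁻¹) • s.G i)
  { s with
    x := x'
    model := Function.update s.model j x'
    k := s.k + 1
    S := s.S.erase j }

/-- Phase 2 begins: the temporary table is emptied. -/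
def State.beginUpdates {d n : ℕ} (s : State d n) : State d n :=
  { s with phase := .update, Gplus := 0, bplus := 0, Splus := ∅ }

/-- If every worker has been updated, Phase 2 is over: the temporary table becomes the main table
and the server returns to Phase 1. -/
def State.endRound {d n : ℕ} (s : State d n) : State d n :=
  if s.S = ∅ then
    { s with phase := .collect, G := s.Gplus, b := s.bplus, S := s.Splus }
  else s

/-- The server's reaction to a gradient `g` received from worker `j`. Phase 1 stops as soon as the
harmonic mean of the batch sizes reaches `thr`; the worker whose gradient made it stop is the first
one to be updated in Phase 2. The table of a new round has no entry for the worker that was updated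
last, so Phase 1 never stops before a gradient has been received. -/
def State.receive {d n : ℕ} (γ thr : ℝ) (s : State d n) (j : Fin n) (g : Vec d) : State d n :=
  match s.phase with
  | .collect =>
      let s' := { s.addToTable j g with S := insert j s.S }
      open Classical in
      if thr ≤ harmonicMean s'.b then (s'.descend γ j).beginUpdates.endRound else s'
  | .update =>
      if j ∈ s.S then ((s.addToTable j g).descend γ j).endRound
      else s.buffer j g

/-- One arrival: worker `j` completes a stochastic gradient at its current model, using its next
sample, and the server reacts. -/
def State.step {d n : ℕ} {Ξ : Fin n → Type*} (F : ∀ i, Vec d → Ξ i → ℝ) (γ thr : ℝ)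
    (ξ : ∀ i, ℕ → Ξ i) (s : State d n) (j : Fin n) : State d n :=
  let s' := s.receive γ thr j (stochGrad F j (s.model j) (ξ j (s.done j)))
  { s' with done := Function.update s.done j (s.done j + 1) }

/-- The state after the first `q` arrivals, where `ξ i m` is the sample that worker `i` uses for
its gradient number `m` (counted from zero). -/
def run {d n : ℕ} {Ξ : Fin n → Type*} (F : ∀ i, Vec d → Ξ i → ℝ) (γ thr : ℝ) (x₀ : Vec d)
    (ξ : ∀ i, ℕ → Ξ i) (worker : ℕ → Fin n) : ℕ → State d n
  | 0 => State.init x₀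
  | q + 1 => (run F γ thr x₀ ξ worker q).step F γ thr ξ (worker q)

end Ringleader

end

/-! Which gradients enter which table, and when the model is updated, depends only on the order of
the arrivals and not on the samples. This deterministic skeleton (`schedule`, `tableRound`, `table`)
splits the proof into a count of rounds and an estimate of the descent per round.

Count. Between `T k` and `T (k+1)` the workers deliver batches whose harmonic mean reaches the
threshold. A server that stayed in Phase 1 for the whole window would have met its stopping rule; a
server that stayed in Phase 2 would have heard from, and hence updated, every worker. So each window
completes at least one phase (`le_progress`), and `K / 2` rounds are over by time `T K`
(`exists_index_round`).

Descent. All gradients of worker `i` in the table of one round are taken at a single point `y i`,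
the model it was sent in the preceding round (initially `x₀`). So the `n` updates of a round that
starts at `z` all have the form `-γ (H + e l)` with the same `H`, the mean of the `∇f_i(y i)`. The
potential `E[f(z) + L/(20n) ∑ ‖z - y i‖²]` absorbs the staleness of the `y i`: it falls by at least
`(E‖∇f(z)‖² - 0.22 ε) / (20 L)` per round (`round_decrease`, `potential_decrease`). The stopping
rule gives `E‖e l‖² ≤ ε`. Moreover `e l` is orthogonal to everything determined by the tables of
earlier rounds, in particular to `∇f(z)` (`isRoundError`). The errors within one round share samples
and are correlated, but only their second moments are needed.

If no iterate formed so far were stationary, each of the `K / 2` rounds would cost `0.039 ε / L` out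
of a budget `Δ`, which is impossible for `K ≥ 160 L Δ / ε`. -/

noncomputable section

namespace Ringleader

open MeasureTheory ProbabilityTheory

/-! ### The deterministic schedule of the algorithm -/

/-- The part of the state that depends on the order of the arrivals only: the number of completed
rounds, the workers updated in the current round, and the batch sizes of both tables. -/
@[ext] structure Schedule (n : ℕ) where
  round : ℕ
  updated : Finset (Fin n)
  b : Fin n → ℕ
  bplus : Fin n → ℕ

namespace Schedule

variable {n : ℕ}

/-- The arrival of worker `j` ends with an update of the model. -/
def Descends (thr : ℝ) (s : Schedule n) (j : Fin n) : Prop :=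
  j ∉ s.updated ∧
    (s.updated ≠ ∅ ∨ thr ≤ harmonicMean (Function.update s.b j (s.b j + 1)))

open Classical in
/-- The effect of an arrival on the schedule. -/
def step (thr : ℝ) (s : Schedule n) (j : Fin n) : Schedule n :=
  if j ∈ s.updated then { s with bplus := Function.update s.bplus j (s.bplus j + 1) }
  else if s.Descends thr j then
    if insert j s.updated = Finset.univ then ⟨s.round + 1, ∅, s.bplus, 0⟩
    else ⟨s.round, insert j s.updated, Function.update s.b j (s.b j + 1), s.bplus⟩
  else { s with b := Function.update s.b j (s.b j + 1) }

theorem step_of_mem {thr : ℝ} {s : Schedule n} {j : Fin n} (h : j ∈ s.updated) :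
    s.step thr j = { s with bplus := Function.update s.bplus j (s.bplus j + 1) } := by
  simp [step, h]

theorem step_of_not_descends {thr : ℝ} {s : Schedule n} {j : Fin n} (h : j ∉ s.updated)
    (h' : ¬ s.Descends thr j) :
    s.step thr j = { s with b := Function.update s.b j (s.b j + 1) } := by
  simp [step, h, h']

theorem step_of_descends {thr : ℝ} {s : Schedule n} {j : Fin n} (h : s.Descends thr j)
    (h' : insert j s.updated ≠ Finset.univ) :
    s.step thr j =
      ⟨s.round, insert j s.updated, Function.update s.b j (s.b j + 1), s.bplus⟩ := by
  simp [step, h.1, h, h']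

theorem step_of_last {thr : ℝ} {s : Schedule n} {j : Fin n} (h : s.Descends thr j)
    (h' : insert j s.updated = Finset.univ) :
    s.step thr j = ⟨s.round + 1, ∅, s.bplus, 0⟩ := by
  simp [step, h.1, h, h']

theorem updated_eq_empty_of_not_descends {thr : ℝ} {s : Schedule n} {j : Fin n}
    (h : j ∉ s.updated) (h' : ¬ s.Descends thr j) : s.updated = ∅ := by
  by_contra h0
  exact h' ⟨h, Or.inl h0⟩

end Schedule

/-! ### Elementary properties of the harmonic mean -/

theorem harmonicMean_mono {n : ℕ} {a b : Fin n → ℕ} (hab : ∀ i, a i ≤ b i) :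
    harmonicMean a ≤ harmonicMean b := by
  unfold harmonicMean
  by_cases ha : ∀ i, 0 < a i
  · have hb : ∀ i, 0 < b i := fun i => (ha i).trans_le (hab i)
    rw [if_pos ha, if_pos hb]
    rcases Nat.eq_zero_or_pos n with rfl | hn
    · simp
    have : Nonempty (Fin n) := ⟨⟨0, hn⟩⟩
    have hn' : (0 : ℝ) < n := by exact_mod_cast hn
    apply inv_anti₀
    · apply mul_pos (by positivity)
      exact Finset.sum_pos (fun i _ => inv_pos.2 (by exact_mod_cast hb i)) Finset.univ_nonempty
    · gcongr with i
      · exact_mod_cast ha i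
      · exact hab i
  · rw [if_neg ha]
    split_ifs
    · positivity
    · exact le_rfl

theorem pos_of_harmonicMean_pos {n : ℕ} {b : Fin n → ℕ} (h : 0 < harmonicMean b) (i : Fin n) :
    0 < b i := by
  unfold harmonicMean at h
  split_ifs at h with hb
  · exact hb i
  · exact absurd h (lt_irrefl _)

theorem harmonicMean_eq_zero {n : ℕ} {b : Fin n → ℕ} {i : Fin n} (h : b i = 0) :
    harmonicMean b = 0 := by
  unfold harmonicMean
  rw [if_neg]
  intro hb
  exact absurd (hb i) (by simp [h])

namespace Schedule

variable {n : ℕ}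

/-- The properties of the schedule that hold after any number of arrivals. -/
structure Valid (thr : ℝ) (s : Schedule n) : Prop where
  ne_univ : s.updated ≠ Finset.univ
  lt_thr : s.updated = ∅ → harmonicMean s.b < thr
  thr_le : s.updated ≠ ∅ → thr ≤ harmonicMean s.b
  bplus_eq_zero : ∀ i ∉ s.updated, s.bplus i = 0

theorem le_update_succ (b : Fin n → ℕ) (j i : Fin n) :
    b i ≤ Function.update b j (b j + 1) i := by
  by_cases h : i = j
  · subst h; simp
  · simp [h]

theorem Valid.thr_le_of_descends {thr : ℝ} {s : Schedule n} (hs : s.Valid thr) {j : Fin n}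
    (h : s.Descends thr j) : thr ≤ harmonicMean (Function.update s.b j (s.b j + 1)) := by
  rcases h.2 with h | h
  · exact (hs.thr_le h).trans (harmonicMean_mono (le_update_succ s.b j))
  · exact h

/-- Main-table counts only grow within a round, so the stopping rule, once met, stays met throughout
Phase 2. -/
theorem Valid.step {thr : ℝ} (hthr : 0 < thr) {s : Schedule n} (hs : s.Valid thr) (j : Fin n) :
    (s.step thr j).Valid thr := by
  by_cases hj : j ∈ s.updated
  · rw [step_of_mem hj]
    refine ⟨hs.ne_univ, hs.lt_thr, hs.thr_le, fun i hi => ?_⟩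
    have : i ≠ j := by rintro rfl; exact hi hj
    simpa [this] using hs.bplus_eq_zero i hi
  by_cases hd : s.Descends thr j
  · by_cases hl : insert j s.updated = Finset.univ
    · rw [step_of_last hd hl]
      refine ⟨fun h => ?_, fun _ => ?_, fun h => absurd rfl h, fun i _ => rfl⟩
      · have := Finset.mem_univ j
        rw [← h] at this
        simp at this
      -- The worker updated last has nothing in the temporary table, so the new round starts with
      -- harmonic mean `0` and Phase 1 cannot already be over.
      · rw [harmonicMean_eq_zero (hs.bplus_eq_zero j hj)]
        exact hthr
    · rw [step_of_descends hd hl]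
      refine ⟨hl, fun h => absurd h (Finset.insert_ne_empty _ _),
        fun _ => hs.thr_le_of_descends hd, fun i hi => hs.bplus_eq_zero i ?_⟩
      exact fun h => hi (Finset.mem_insert_of_mem h)
  · have h0 := updated_eq_empty_of_not_descends hj hd
    rw [step_of_not_descends hj hd]
    refine ⟨hs.ne_univ, fun _ => ?_, fun h => absurd h0 h, hs.bplus_eq_zero⟩
    by_contra h
    exact hd ⟨hj, Or.inr (not_lt.1 h)⟩

end Schedule

/-! ### The tables as sets of arrivals -/

section

variable {n : ℕ} (thr : ℝ) (worker : ℕ → Fin n)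

/-- The schedule after the first `q` arrivals. -/
def schedule : ℕ → Schedule n
  | 0 => ⟨0, ∅, 0, 0⟩
  | q + 1 => (schedule q).step thr (worker q)

theorem schedule_valid (hn : 0 < n) (hthr : 0 < thr) (q : ℕ) :
    (schedule thr worker q).Valid thr := by
  induction q with
  | zero =>
    refine ⟨fun h => ?_, fun _ => ?_, fun h => absurd rfl h, fun _ _ => rfl⟩
    · have := Finset.mem_univ (⟨0, hn⟩ : Fin n)
      rw [← h] at this
      simp [schedule] at this
    · rw [harmonicMean_eq_zero (i := ⟨0, hn⟩) rfl]
      exact hthr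
  | succ q ih => exact ih.step hthr _

/-- The round in whose table the gradient of arrival `q` is used. -/
def tableRound (q : ℕ) : ℕ :=
  if worker q ∈ (schedule thr worker q).updated then (schedule thr worker q).round + 1
  else (schedule thr worker q).round

/-- The arrivals among the first `q` that contribute to the table of round `t` for worker `i`. -/
def table (t : ℕ) (i : Fin n) (q : ℕ) : Finset ℕ :=
  (Finset.range q).filter fun r => worker r = i ∧ tableRound thr worker r = t

theorem mem_table {t : ℕ} {i : Fin n} {q r : ℕ} :
    r ∈ table thr worker t i q ↔ r < q ∧ worker r = i ∧ tableRound thr worker r = t := by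
  simp [table]

theorem table_succ_of_eq {t q : ℕ} (h : tableRound thr worker q = t) :
    table thr worker t (worker q) (q + 1) = insert q (table thr worker t (worker q) q) := by
  simp [table, Finset.range_add_one, Finset.filter_insert, h]

theorem table_succ_of_ne {t q : ℕ} {i : Fin n}
    (h : worker q ≠ i ∨ tableRound thr worker q ≠ t) :
    table thr worker t i (q + 1) = table thr worker t i q := by
  rw [table, table, Finset.range_add_one, Finset.filter_insert, if_neg]
  tauto

theorem notMem_table_self {t q : ℕ} {i : Fin n} : q ∉ table thr worker t i q := by
  simp [mem_table]

/-- The summand is arbitrary so that `g = 1` yields the batch sizes and `g` the arrived gradients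
yields the gradient sums. -/
theorem sum_table_succ {M : Type*} [AddCommMonoid M] (g : ℕ → M) {t q : ℕ}
    (h : tableRound thr worker q = t) (i : Fin n) :
    ∑ r ∈ table thr worker t i (q + 1), g r =
      Function.update (fun i => ∑ r ∈ table thr worker t i q, g r) (worker q)
        ((∑ r ∈ table thr worker t (worker q) q, g r) + g q) i := by
  by_cases hi : i = worker q
  · subst hi
    rw [table_succ_of_eq thr worker h, Finset.sum_insert (notMem_table_self thr worker)]
    simp [add_comm]
  · rw [table_succ_of_ne thr worker (Or.inl (Ne.symm hi))]
    simp [hi]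

/-- Arrival `q` leads to a step of the algorithm. -/
abbrev DescendsAt (q : ℕ) : Prop := (schedule thr worker q).Descends thr (worker q)

theorem tableRound_of_mem {q : ℕ} (h : worker q ∈ (schedule thr worker q).updated) :
    tableRound thr worker q = (schedule thr worker q).round + 1 := by
  simp [tableRound, h]

theorem tableRound_of_notMem {q : ℕ} (h : worker q ∉ (schedule thr worker q).updated) :
    tableRound thr worker q = (schedule thr worker q).round := by
  simp [tableRound, h]

/-- Gradients are put aside for the next round only during Phase 2; hence in Phase 1 nothing is
stored for any later round. -/
theorem tableRound_le {q r : ℕ} (h : r < q) :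
    tableRound thr worker r ≤ (schedule thr worker q).round +
      if (schedule thr worker q).updated = ∅ then 0 else 1 := by
  induction q with
  | zero => omega
  | succ q ih =>
    have hle : tableRound thr worker r ≤ (schedule thr worker q).round +
        if (schedule thr worker q).updated = ∅ then 0 else 1 := by
      rcases Nat.lt_succ_iff_lt_or_eq.1 h with h | rfl
      · exact ih h
      · rw [tableRound]
        split_ifs with h1 h2 h2
        · simp [h2] at h1
        all_goals omega
    refine hle.trans ?_
    rw [schedule]
    set s := schedule thr worker q
    by_cases hj : worker q ∈ s.updated
    · rw [Schedule.step_of_mem hj]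
    by_cases hd : s.Descends thr (worker q)
    · by_cases hl : insert (worker q) s.updated = Finset.univ
      · rw [Schedule.step_of_last hd hl]
        simp; split_ifs <;> omega
      · rw [Schedule.step_of_descends hd hl]
        simp; split_ifs <;> omega
    · rw [Schedule.step_of_not_descends hj hd]

theorem schedule_b (hn : 0 < n) (hthr : 0 < thr) (q : ℕ) :
    (∀ i, (schedule thr worker q).b i =
      (table thr worker (schedule thr worker q).round i q).card) ∧
    ∀ i, (schedule thr worker q).bplus i =
      (table thr worker ((schedule thr worker q).round + 1) i q).card := by
  induction q with
  | zero => exact ⟨fun _ => rfl, fun _ => rfl⟩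
  | succ q ih =>
    -- This justifies the value `0` given to the temporary counts when a round ends.
    have hnew : (schedule thr worker (q + 1)).updated = ∅ →
        ∀ i, (table thr worker ((schedule thr worker (q + 1)).round + 1) i (q + 1)).card = 0 := by
      intro h i
      rw [Finset.card_eq_zero, Finset.eq_empty_iff_forall_notMem]
      intro r hr
      rw [mem_table] at hr
      have := tableRound_le thr worker hr.1
      rw [if_pos h] at this
      omega
    have hval := schedule_valid thr worker hn hthr q
    have hsum := fun t (h : tableRound thr worker q = t) i =>
      sum_table_succ thr worker (fun _ => 1) h i
    simp only [Finset.sum_const, smul_eq_mul, mul_one] at hsum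
    rw [schedule] at hnew ⊢
    set s := schedule thr worker q with hs
    by_cases hj : worker q ∈ s.updated
    · have ht : tableRound thr worker q = s.round + 1 := tableRound_of_mem thr worker hj
      rw [Schedule.step_of_mem hj]
      refine ⟨fun i => ?_, fun i => ?_⟩
      · rw [table_succ_of_ne thr worker (Or.inr (by dsimp only; omega))]
        exact ih.1 i
      · rw [hsum _ ht]
        simp only [← ih.2]
    have ht : tableRound thr worker q = s.round := tableRound_of_notMem thr worker hj
    have hb : ∀ i, Function.update s.b (worker q) (s.b (worker q) + 1) i =
        (table thr worker s.round i (q + 1)).card := by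
      intro i
      rw [hsum _ ht]
      simp only [← ih.1]
    have hbp : ∀ i, s.bplus i = (table thr worker (s.round + 1) i (q + 1)).card := by
      intro i
      rw [table_succ_of_ne thr worker (Or.inr (by omega))]
      exact ih.2 i
    by_cases hd : s.Descends thr (worker q)
    · by_cases hl : insert (worker q) s.updated = Finset.univ
      · rw [Schedule.step_of_last hd hl] at hnew ⊢
        exact ⟨hbp, fun i => (hnew rfl i).symm⟩
      · rw [Schedule.step_of_descends hd hl]
        exact ⟨hb, hbp⟩
    · rw [Schedule.step_of_not_descends hj hd]
      exact ⟨hb, hbp⟩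

end

/-! ### The state of the algorithm follows the schedule -/

variable {d n : ℕ}

/-- The state `s` agrees with the schedule `c`. -/
structure State.Follows (s : State d n) (c : Schedule n) : Prop where
  phase : s.phase = if c.updated = ∅ then Phase.collect else Phase.update
  b : s.b = c.b
  S_collect : c.updated = ∅ → ∀ i, i ∈ s.S ↔ 0 < c.b i
  S_update : c.updated ≠ ∅ → s.S = c.updatedᶜ
  bplus : c.updated ≠ ∅ → s.bplus = c.bplus
  Splus : c.updated ≠ ∅ → ∀ i, i ∈ s.Splus ↔ 0 < c.bplus i

/-- The model obtained from the table `(G, b)` of the state `s` by an update. -/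
def State.next (γ : ℝ) (s : State d n) (b : Fin n → ℕ) (G : Fin n → Vec d) : Vec d :=
  s.x - γ • ((1 / (n : ℝ)) • ∑ i, ((b i : ℝ)⁻¹) • G i)

theorem pos_update_iff (b : Fin n → ℕ) (j i : Fin n) (S : Finset (Fin n))
    (h : ∀ i, i ∈ S ↔ 0 < b i) :
    i ∈ insert j S ↔ 0 < Function.update b j (b j + 1) i := by
  by_cases hi : i = j
  · subst hi; simp
  · simp [hi, h]

theorem State.receive_of_mem {γ thr : ℝ} {s : State d n} {c : Schedule n} (hs : s.Follows c)
    {j : Fin n} (g : Vec d) (hj : j ∈ c.updated) :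
    s.receive γ thr j g = s.buffer j g := by
  have h0 : c.updated ≠ ∅ := Finset.ne_empty_of_mem hj
  have hph : s.phase = .update := by rw [hs.phase, if_neg h0]
  simp [State.receive, hph, hs.S_update h0, hj]

theorem State.receive_of_not_descends {γ thr : ℝ} {s : State d n} {c : Schedule n}
    (hs : s.Follows c) {j : Fin n} (g : Vec d) (hj : j ∉ c.updated) (hd : ¬ c.Descends thr j) :
    s.receive γ thr j g = { s.addToTable j g with S := insert j s.S } := by
  have h0 := Schedule.updated_eq_empty_of_not_descends hj hd
  have hph : s.phase = .collect := by rw [hs.phase, if_pos h0]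
  have hb : ¬ thr ≤ harmonicMean (Function.update c.b j (c.b j + 1)) :=
    fun h => hd ⟨hj, Or.inr h⟩
  simp only [State.receive, hph, State.addToTable, hs.b]
  rw [if_neg hb]

/-- The state after an update, before it is checked whether the round is over. -/
def State.afterUpdate (γ : ℝ) (s : State d n) (c : Schedule n) (j : Fin n) (g : Vec d) :
    State d n :=
  open Classical in
  { s with
    phase := .update
    k := s.k + 1
    x := s.next γ (Function.update s.b j (s.b j + 1)) (Function.update s.G j (s.G j + g))
    G := Function.update s.G j (s.G j + g)
    b := Function.update s.b j (s.b j + 1)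
    S := (insert j c.updated)ᶜ
    Gplus := if c.updated = ∅ then 0 else s.Gplus
    bplus := if c.updated = ∅ then 0 else s.bplus
    Splus := if c.updated = ∅ then ∅ else s.Splus
    model := Function.update s.model j
      (s.next γ (Function.update s.b j (s.b j + 1)) (Function.update s.G j (s.G j + g))) }

theorem State.endRound_of_ne {s : State d n} (h : s.S ≠ ∅) : s.endRound = s := if_neg h

theorem State.endRound_of_eq {s : State d n} (h : s.S = ∅) :
    s.endRound = { s with phase := .collect, G := s.Gplus, b := s.bplus, S := s.Splus } := if_pos h

theorem State.afterUpdate_S_ne {γ : ℝ} {s : State d n} {c : Schedule n} {j : Fin n} {g : Vec d}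
    (h : insert j c.updated ≠ Finset.univ) : (s.afterUpdate γ c j g).S ≠ ∅ := by
  classical
  simp only [State.afterUpdate]
  rw [Ne, Finset.compl_eq_empty_iff]
  convert h

theorem State.afterUpdate_S_eq {γ : ℝ} {s : State d n} {c : Schedule n} {j : Fin n} {g : Vec d}
    (h : insert j c.updated = Finset.univ) : (s.afterUpdate γ c j g).S = ∅ := by
  classical
  simp only [State.afterUpdate]
  rw [Finset.compl_eq_empty_iff]
  convert h

/-- The update that ends Phase 1 and the later ones of the round get one common formula; they differ
only in whether the temporary table is emptied. -/
theorem State.receive_of_descends {γ thr : ℝ} (hthr : 0 < thr) {s : State d n} {c : Schedule n}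
    (hs : s.Follows c) (hc : c.Valid thr) {j : Fin n} (g : Vec d) (hd : c.Descends thr j) :
    s.receive γ thr j g = (s.afterUpdate γ c j g).endRound := by
  have hle := hc.thr_le_of_descends hd
  by_cases h0 : c.updated = ∅
  · have hph : s.phase = .collect := by rw [hs.phase, if_pos h0]
    -- A positive harmonic mean means that every worker has an entry, so Phase 2 starts with all
    -- workers waiting for an update.
    have hS : insert j s.S = Finset.univ := by
      ext i
      rw [pos_update_iff c.b j i s.S (hs.S_collect h0)]
      simpa using pos_of_harmonicMean_pos (hthr.trans_le hle) i
    simp only [State.receive, hph, State.addToTable, hs.b]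
    rw [if_pos hle]
    simp only [State.descend, State.beginUpdates, State.afterUpdate, hS, h0, State.next, hs.b,
      if_true]
    congr 2
    ext i; simp
  · have hph : s.phase = .update := by rw [hs.phase, if_neg h0]
    have hj : j ∈ s.S := by rw [hs.S_update h0]; simpa using hd.1
    simp only [State.receive, hph, hj, if_true]
    simp only [State.descend, State.addToTable, State.afterUpdate, h0, State.next, if_false,
      hs.S_update h0]
    congr 2
    · ext i; simp

/-- In Phase 1 the temporary table of the state may still hold entries already moved to the main
table, whereas that of the schedule is zero. The two agree again once the first update of the round
empties the former, so they are compared in Phase 2 only. -/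
theorem State.Follows.receive {γ thr : ℝ} (hthr : 0 < thr) {s : State d n} {c : Schedule n}
    (hs : s.Follows c) (hc : c.Valid thr) (j : Fin n) (g : Vec d) :
    (s.receive γ thr j g).Follows (c.step thr j) := by
  by_cases hj : j ∈ c.updated
  · have h0 : c.updated ≠ ∅ := Finset.ne_empty_of_mem hj
    rw [State.receive_of_mem hs g hj, Schedule.step_of_mem hj]
    refine ⟨hs.phase, hs.b, fun h => absurd h h0, hs.S_update, fun _ => ?_, fun _ i => ?_⟩
    · simp [State.buffer, hs.bplus h0]
    · simp only [State.buffer]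
      exact pos_update_iff _ _ _ _ (hs.Splus h0)
  by_cases hd : c.Descends thr j
  · rw [State.receive_of_descends hthr hs hc g hd]
    by_cases hl : insert j c.updated = Finset.univ
    · rw [Schedule.step_of_last hd hl]
      rw [State.endRound_of_eq (State.afterUpdate_S_eq hl)]
      simp only [State.afterUpdate]
      refine ⟨by simp, ?_, fun _ i => ?_, fun h => absurd rfl h, fun h => absurd rfl h,
        fun h => absurd rfl h⟩
      · by_cases h0 : c.updated = ∅
        · ext i; simp [h0, hc.bplus_eq_zero i]
        · simp [h0, hs.bplus h0]
      · by_cases h0 : c.updated = ∅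
        · simp [h0, hc.bplus_eq_zero i]
        · simp [h0, hs.Splus h0]
    · rw [Schedule.step_of_descends hd hl]
      rw [State.endRound_of_ne (State.afterUpdate_S_ne hl)]
      simp only [State.afterUpdate]
      refine ⟨by simp, by simp [hs.b], fun h => absurd h (Finset.insert_ne_empty _ _),
        fun _ => rfl, fun _ => ?_, fun _ i => ?_⟩
      · by_cases h0 : c.updated = ∅
        · ext i; simp [h0, hc.bplus_eq_zero i]
        · simp [h0, hs.bplus h0]
      · by_cases h0 : c.updated = ∅
        · simp [h0, hc.bplus_eq_zero i]
        · simp [h0, hs.Splus h0]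
  · have h0 := Schedule.updated_eq_empty_of_not_descends hj hd
    rw [State.receive_of_not_descends hs g hj hd, Schedule.step_of_not_descends hj hd]
    refine ⟨hs.phase, by simp [State.addToTable, hs.b], fun _ i => ?_, fun h => absurd h0 h,
      fun h => absurd h0 h, fun h => absurd h0 h⟩
    exact pos_update_iff _ _ _ _ (hs.S_collect h0)

theorem State.Follows.step {Ξ : Fin n → Type*} (F : ∀ i, Vec d → Ξ i → ℝ) (γ : ℝ) {thr : ℝ}
    (hthr : 0 < thr) (ξ : ∀ i, ℕ → Ξ i) {s : State d n} {c : Schedule n}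
    (hs : s.Follows c) (hc : c.Valid thr) (j : Fin n) :
    (s.step F γ thr ξ j).Follows (c.step thr j) := by
  have h := hs.receive (γ := γ) hthr hc j (stochGrad F j (s.model j) (ξ j (s.done j)))
  exact ⟨h.phase, h.b, h.S_collect, h.S_update, h.bplus, h.Splus⟩

/-! ### Tables and updates along a run -/

section Run

variable {Ξ : Fin n → Type*} (F : ∀ i, Vec d → Ξ i → ℝ) (γ thr : ℝ) (x₀ : Vec d)
  (ξ : ∀ i, ℕ → Ξ i) (worker : ℕ → Fin n)

theorem run_follows (hn : 0 < n) (hthr : 0 < thr) (q : ℕ) :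
    (run F γ thr x₀ ξ worker q).Follows (schedule thr worker q) := by
  induction q with
  | zero =>
    exact ⟨by simp [run, schedule, State.init], rfl, fun _ i => by simp [run, State.init, schedule],
      fun h => absurd rfl h, fun h => absurd rfl h, fun h => absurd rfl h⟩
  | succ q ih => exact ih.step F γ hthr ξ (schedule_valid thr worker hn hthr q) _

/-- The number of gradients of worker `i` among the first `q` arrivals. -/
def arrivalCount (i : Fin n) (q : ℕ) : ℕ := ((Finset.range q).filter fun r => worker r = i).card

theorem arrivalCount_succ (i : Fin n) (q : ℕ) :
    arrivalCount worker i (q + 1) = arrivalCount worker i q + if worker q = i then 1 else 0 := by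
  rw [arrivalCount, arrivalCount, Finset.range_add_one, Finset.filter_insert]
  split_ifs
  · rw [Finset.card_insert_of_notMem (by simp)]
  · simp

theorem run_done (q : ℕ) (i : Fin n) :
    (run F γ thr x₀ ξ worker q).done i = arrivalCount worker i q := by
  induction q with
  | zero => simp [run, State.init, arrivalCount]
  | succ q ih =>
    rw [arrivalCount_succ, ← ih, run, State.step]
    by_cases h : i = worker q
    · subst h; simp
    · simp [h, Ne.symm h]

/-- The stochastic gradient that arrives at the server as number `q`. -/
def arrivedGrad (q : ℕ) : Vec d :=
  stochGrad F (worker q) ((run F γ thr x₀ ξ worker q).model (worker q))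
    (ξ (worker q) (arrivalCount worker (worker q) q))

theorem run_succ (q : ℕ) :
    run F γ thr x₀ ξ worker (q + 1) =
      { (run F γ thr x₀ ξ worker q).receive γ thr (worker q)
          (arrivedGrad F γ thr x₀ ξ worker q) with
        done := Function.update (run F γ thr x₀ ξ worker q).done (worker q)
          ((run F γ thr x₀ ξ worker q).done (worker q) + 1) } := by
  rw [run, State.step, arrivedGrad, ← run_done F γ thr x₀ ξ worker]

theorem run_tables (hn : 0 < n) (hthr : 0 < thr) (q : ℕ) :
    (∀ i, (run F γ thr x₀ ξ worker q).G i =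
      ∑ r ∈ table thr worker (schedule thr worker q).round i q,
        arrivedGrad F γ thr x₀ ξ worker r) ∧
    ((schedule thr worker q).updated ≠ ∅ → ∀ i, (run F γ thr x₀ ξ worker q).Gplus i =
      ∑ r ∈ table thr worker ((schedule thr worker q).round + 1) i q,
        arrivedGrad F γ thr x₀ ξ worker r) := by
  induction q with
  | zero => exact ⟨fun i => by simp [run, State.init, table], fun h => absurd rfl h⟩
  | succ q ih =>
    have hfol := run_follows F γ thr x₀ ξ worker hn hthr q
    have hval := schedule_valid thr worker hn hthr q
    have hbp := (schedule_b thr worker hn hthr q).2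
    have hsum := fun t (h : tableRound thr worker q = t) i =>
      sum_table_succ thr worker (arrivedGrad F γ thr x₀ ξ worker) h i
    rw [run_succ, schedule]
    set g := arrivedGrad F γ thr x₀ ξ worker with hg
    set s := run F γ thr x₀ ξ worker q with hs
    set c := schedule thr worker q with hc
    by_cases hj : worker q ∈ c.updated
    · have h0 : c.updated ≠ ∅ := Finset.ne_empty_of_mem hj
      have ht : tableRound thr worker q = c.round + 1 := tableRound_of_mem thr worker hj
      rw [Schedule.step_of_mem hj, State.receive_of_mem hfol _ hj]
      refine ⟨fun i => ?_, fun _ i => ?_⟩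
      · rw [table_succ_of_ne thr worker (Or.inr (by dsimp only; omega))]
        exact ih.1 i
      · simp only [State.buffer]
        rw [hsum _ ht]
        simp only [← ih.2 h0]
    have ht : tableRound thr worker q = c.round := tableRound_of_notMem thr worker hj
    have hG : ∀ i, Function.update s.G (worker q) (s.G (worker q) + g q) i =
        ∑ r ∈ table thr worker c.round i (q + 1), g r := by
      intro i
      rw [hsum _ ht]
      simp only [← ih.1]
    by_cases hd : c.Descends thr (worker q)
    · have hGp : ∀ i, (if c.updated = ∅ then (0 : Fin n → Vec d) else s.Gplus) i =
          ∑ r ∈ table thr worker (c.round + 1) i (q + 1), g r := by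
        intro i
        rw [table_succ_of_ne thr worker (Or.inr (by omega))]
        -- At the first update of a round the table is emptied; this matches the sum because no
        -- arrival has yet been assigned to the next round.
        by_cases h0 : c.updated = ∅
        · have : (table thr worker (c.round + 1) i q) = ∅ := by
            rw [← Finset.card_eq_zero, ← hbp]
            exact hval.bplus_eq_zero i (by simp [h0])
          simp [h0, this]
        · rw [if_neg h0]
          exact ih.2 h0 i
      rw [State.receive_of_descends hthr hfol hval _ hd]
      by_cases hl : insert (worker q) c.updated = Finset.univ
      · rw [Schedule.step_of_last hd hl]
        rw [State.endRound_of_eq (State.afterUpdate_S_eq hl)]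
        simp only [State.afterUpdate]
        exact ⟨fun i => by convert hGp i, fun h => absurd rfl h⟩
      · rw [Schedule.step_of_descends hd hl]
        rw [State.endRound_of_ne (State.afterUpdate_S_ne hl)]
        simp only [State.afterUpdate]
        exact ⟨hG, fun _ i => by convert hGp i⟩
    · have h0 := Schedule.updated_eq_empty_of_not_descends hj hd
      rw [Schedule.step_of_not_descends hj hd, State.receive_of_not_descends hfol _ hj hd]
      exact ⟨hG, fun h => absurd h0 h⟩

theorem run_succ_of_not_descends (hn : 0 < n) (hthr : 0 < thr) {q : ℕ}
    (hd : ¬ DescendsAt thr worker q) :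
    (run F γ thr x₀ ξ worker (q + 1)).x = (run F γ thr x₀ ξ worker q).x ∧
      (run F γ thr x₀ ξ worker (q + 1)).model = (run F γ thr x₀ ξ worker q).model := by
  have hfol := run_follows F γ thr x₀ ξ worker hn hthr q
  rw [run_succ]
  by_cases hj : worker q ∈ (schedule thr worker q).updated
  · rw [State.receive_of_mem hfol _ hj]
    exact ⟨rfl, rfl⟩
  · rw [State.receive_of_not_descends hfol _ hj hd]
    exact ⟨rfl, rfl⟩

theorem run_succ_of_descends (hn : 0 < n) (hthr : 0 < thr) {q : ℕ}
    (hd : DescendsAt thr worker q) :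
    (run F γ thr x₀ ξ worker (q + 1)).x = (run F γ thr x₀ ξ worker q).x -
      γ • ((1 / (n : ℝ)) • ∑ i,
        ((table thr worker (schedule thr worker q).round i (q + 1)).card : ℝ)⁻¹ •
          ∑ r ∈ table thr worker (schedule thr worker q).round i (q + 1),
            arrivedGrad F γ thr x₀ ξ worker r) ∧
      (run F γ thr x₀ ξ worker (q + 1)).model =
        Function.update (run F γ thr x₀ ξ worker q).model (worker q)
          (run F γ thr x₀ ξ worker (q + 1)).x := by
  have hfol := run_follows F γ thr x₀ ξ worker hn hthr q
  have hval := schedule_valid thr worker hn hthr q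
  have ht := tableRound_of_notMem thr worker hd.1
  have h1 : ∀ t : State d n, t.endRound.x = t.x ∧ t.endRound.model = t.model := by
    intro t
    rw [State.endRound]
    split_ifs <;> exact ⟨rfl, rfl⟩
  rw [run_succ, State.receive_of_descends hthr hfol hval _ hd]
  simp only [(h1 _).1, (h1 _).2]
  refine ⟨?_, rfl⟩
  simp only [State.afterUpdate, State.next]
  congr 3
  refine Finset.sum_congr rfl fun i _ => ?_
  have hc := sum_table_succ thr worker (fun _ => 1) ht i
  simp only [Finset.sum_const, smul_eq_mul, mul_one] at hc
  rw [sum_table_succ thr worker _ ht i, hc, hfol.b]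
  simp only [← (run_tables F γ thr x₀ ξ worker hn hthr q).1,
    ← (schedule_b thr worker hn hthr q).1]
end Run

/-! ### How many rounds are completed by a given time -/

section

variable {n : ℕ} (thr : ℝ) (worker : ℕ → Fin n)

/-- The number of phases completed during the first `q` arrivals. -/
def progress (q : ℕ) : ℕ :=
  2 * (schedule thr worker q).round + if (schedule thr worker q).updated = ∅ then 0 else 1

theorem progress_le_succ (q : ℕ) : progress thr worker q ≤ progress thr worker (q + 1) := by
  rw [progress, progress, schedule]
  set c := schedule thr worker q
  by_cases hj : worker q ∈ c.updated
  · rw [Schedule.step_of_mem hj]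
  by_cases hd : c.Descends thr (worker q)
  · by_cases hl : insert (worker q) c.updated = Finset.univ
    · rw [Schedule.step_of_last hd hl]
      dsimp only
      split_ifs <;> omega
    · rw [Schedule.step_of_descends hd hl]
      simp only [Finset.insert_ne_empty, if_false]
      split_ifs <;> omega
  · rw [Schedule.step_of_not_descends hj hd]

theorem progress_mono : Monotone (progress thr worker) :=
  monotone_nat_of_le_succ (progress_le_succ thr worker)

/-- While no phase ends, Phase 1 puts every arriving gradient into the main table, and Phase 2
updates every worker from which a gradient arrives. -/
theorem arrivals_of_progress_eq {q m : ℕ}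
    (h : progress thr worker (q + m) = progress thr worker q) :
    ((schedule thr worker q).updated = ∅ → (schedule thr worker (q + m)).updated = ∅ ∧
      ∀ i, arrivalCount worker i (q + m) ≤
        arrivalCount worker i q + (schedule thr worker (q + m)).b i) ∧
    ((schedule thr worker q).updated ≠ ∅ →
      ∀ i, arrivalCount worker i q < arrivalCount worker i (q + m) →
        i ∈ (schedule thr worker (q + m)).updated) := by
  induction m with
  | zero => exact ⟨fun h => ⟨h, fun i => Nat.le_add_right _ _⟩, fun _ i h => absurd h (lt_irrefl _)⟩
  | succ m ih =>
    have h1 := progress_mono thr worker (Nat.le_add_right q m)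
    have h2 := progress_le_succ thr worker (q + m)
    rw [← Nat.add_assoc] at h ⊢
    have ih := ih (by omega)
    have h3 : progress thr worker (q + m + 1) = progress thr worker (q + m) := by omega
    simp only [arrivalCount_succ]
    rw [progress, progress, schedule] at h3
    rw [schedule]
    set c := schedule thr worker (q + m)
    set j := worker (q + m)
    by_cases hj : j ∈ c.updated
    · rw [Schedule.step_of_mem hj]
      refine ⟨fun h0 => ?_, fun h0 i hi => ?_⟩
      · rw [(ih.1 h0).1] at hj
        simp at hj
      · by_cases hij : j = i
        · exact hij ▸ hj
        · rw [if_neg hij] at hi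
          exact ih.2 h0 i hi
    by_cases hd : c.Descends thr j
    · by_cases hl : insert j c.updated = Finset.univ
      -- The end of a round would increase the progress.
      · rw [Schedule.step_of_last hd hl] at h3
        dsimp only at h3
        split_ifs at h3 <;> omega
      · rw [Schedule.step_of_descends hd hl] at h3 ⊢
        simp only [Finset.insert_ne_empty, if_false] at h3
        have h0' : c.updated ≠ ∅ := by
          intro h0
          rw [if_pos h0] at h3
          omega
        refine ⟨fun h0 => absurd (ih.1 h0).1 h0', fun h0 i hi => ?_⟩
        by_cases hij : j = i
        · exact hij ▸ Finset.mem_insert_self _ _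
        · rw [if_neg hij] at hi
          exact Finset.mem_insert_of_mem (ih.2 h0 i hi)
    · have h0' := Schedule.updated_eq_empty_of_not_descends hj hd
      rw [Schedule.step_of_not_descends hj hd]
      refine ⟨fun h0 => ⟨h0', fun i => ?_⟩, fun h0 i hi => ?_⟩
      · have := (ih.1 h0).2 i
        by_cases hij : j = i
        · subst hij
          simp only [if_true, Function.update_self]
          omega
        · simp only [if_neg hij, Function.update_of_ne (Ne.symm hij)]
          omega
      · by_cases hij : j = i
        · exfalso
          by_cases hlt : ∃ i, arrivalCount worker i q < arrivalCount worker i (q + m)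
          · obtain ⟨i', hi'⟩ := hlt
            have := ih.2 h0 i' hi'
            rw [h0'] at this
            simp at this
          -- Parity: progress is even in Phase 1 and odd in Phase 2.
          · have hm : progress thr worker (q + m) = progress thr worker q := by omega
            rw [progress, progress, if_neg h0] at hm
            change 2 * c.round + (if c.updated = ∅ then 0 else 1) = _ at hm
            rw [if_pos h0'] at hm
            omega
        · rw [if_neg hij] at hi
          exact ih.2 h0 i hi

/-- Each window completes a phase. Otherwise, in Phase 1 the table would dominate `M k` and meet the
stopping rule; in Phase 2 all entries of `M k` are positive, so every worker would have been updated
and the round would be over. -/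
theorem le_progress (hn : 0 < n) (hthr : 0 < thr) {K : ℕ} (idx : ℕ → ℕ) (M : ℕ → Fin n → ℕ)
    (hidx : ∀ k < K, idx k ≤ idx (k + 1)) (hM : ∀ k < K, thr ≤ harmonicMean (M k))
    (hcount : ∀ k < K, ∀ i,
      arrivalCount worker i (idx k) + M k i ≤ arrivalCount worker i (idx (k + 1))) :
    ∀ k ≤ K, k ≤ progress thr worker (idx k) := by
  intro k
  induction k with
  | zero => intro _; exact Nat.zero_le _
  | succ k ih =>
    intro hk
    have hk' : k < K := hk
    have ih := ih hk'.le
    have hmono := progress_mono thr worker (hidx k hk')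
    by_contra hlt
    obtain ⟨m, hm⟩ := Nat.exists_eq_add_of_le (hidx k hk')
    have hcount := hcount k hk'
    rw [hm] at hmono hlt hcount
    have hstay := arrivals_of_progress_eq thr worker (q := idx k) (m := m) (by omega)
    have hval := schedule_valid thr worker hn hthr (idx k + m)
    by_cases h0 : (schedule thr worker (idx k)).updated = ∅
    · obtain ⟨h1, h2⟩ := hstay.1 h0
      have h3 := hval.lt_thr h1
      have h4 : harmonicMean (M k) ≤ harmonicMean (schedule thr worker (idx k + m)).b :=
        harmonicMean_mono fun i => by have := h2 i; have := hcount i; omega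
      linarith [hM k hk']
    · apply hval.ne_univ
      ext i
      simp only [Finset.mem_univ, iff_true]
      have := pos_of_harmonicMean_pos (hthr.trans_le (hM k hk')) i
      exact hstay.2 h0 i (by have := hcount i; omega)

end

/-! ### From times to arrival indices -/

theorem Arrivals.exists_index {n : ℕ} {p : Fin n → ℝ → ℝ} (A : Arrivals p) {t : ℝ} (ht : 0 ≤ t) :
    ∃ Q, (∀ q, q < Q ↔ A.time q ≤ ENNReal.ofReal t) ∧
      ∀ i, arrivalCount A.worker i Q = ⌊∫ s in (0 : ℝ)..t, p i s⌋₊ := by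
  have hfin : {q | A.time q ≤ ENNReal.ofReal t}.Finite := by
    have : {q | A.time q ≤ ENNReal.ofReal t} =
        ⋃ i, {q | A.worker q = i ∧ A.time q ≤ ENNReal.ofReal t} := by
      ext q; simp
    rw [this]
    refine Set.finite_iUnion fun i => ?_
    rw [← Set.encard_lt_top_iff, A.count i t ht]
    exact ENat.natCast_lt_top _
  obtain ⟨N, hN⟩ : ∃ N, ¬ A.time N ≤ ENNReal.ofReal t := by
    by_contra! h
    exact Set.infinite_univ (hfin.subset fun q _ => h q)
  classical
  have hex : ∃ N, ¬ A.time N ≤ ENNReal.ofReal t := ⟨N, hN⟩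
  have hQ : ∀ q, q < Nat.find hex ↔ A.time q ≤ ENNReal.ofReal t := by
    intro q
    refine ⟨fun h => not_not.1 (Nat.find_min hex h), fun h => ?_⟩
    by_contra hq
    exact Nat.find_spec hex ((A.chronological (not_lt.1 hq)).trans h)
  refine ⟨Nat.find hex, hQ, fun i => ?_⟩
  have h := A.count i t ht
  have hset : {q | A.worker q = i ∧ A.time q ≤ ENNReal.ofReal t} =
      ((Finset.range (Nat.find hex)).filter fun r => A.worker r = i : Finset ℕ) := by
    ext q
    rw [Finset.mem_coe, Finset.mem_filter, Finset.mem_range, hQ]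
    exact and_comm
  rw [hset, Set.encard_coe_eq_coe_finsetCard] at h
  exact_mod_cast h

/-- A gradient half finished at time `s` can only help: the floor is superadditive, so the window
from `s` to `t` brings at least as many gradients as a fresh start at `s`. -/
theorem floor_add_floor_le {p : ℝ → ℝ} (hp : IsComputePower p) {s t : ℝ} (hs : 0 ≤ s)
    (hst : s ≤ t) :
    ⌊∫ u in (0 : ℝ)..s, p u⌋₊ + ⌊∫ u in s..t, p u⌋₊ ≤ ⌊∫ u in (0 : ℝ)..t, p u⌋₊ := by
  have h1 := hp.integrable s hs
  have h2 := hp.integrable t (hs.trans hst)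
  rw [← intervalIntegral.integral_add_adjacent_intervals h1 (h1.symm.trans h2)]
  refine Nat.le_floor ?_
  push_cast
  have ha : 0 ≤ ∫ u in (0 : ℝ)..s, p u :=
    intervalIntegral.integral_nonneg hs fun u hu => hp.nonneg u hu.1
  have hb : 0 ≤ ∫ u in s..t, p u :=
    intervalIntegral.integral_nonneg hst fun u hu => hp.nonneg u (hs.trans hu.1)
  exact add_le_add (Nat.floor_le ha) (Nat.floor_le hb)

theorem threshold_pos (n : ℕ) (σ ε : ℝ) : 0 < threshold n σ ε :=
  lt_of_lt_of_le one_pos (le_max_left _ _)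

/-- An earlier `T (k+1)` would make the integrals nonpositive, hence the counts zero and the
threshold out of reach. -/
theorem IsTimeSequence.le_succ {n : ℕ} (hn : 0 < n) {p : Fin n → ℝ → ℝ}
    (hp : ∀ i, IsComputePower (p i)) {σ ε : ℝ} {K : ℕ} {T : ℕ → ℝ}
    (hT : IsTimeSequence p σ ε K T) {k : ℕ} (hk : k < K) : T k ≤ T (k + 1) := by
  by_contra! hlt
  obtain ⟨h0, h1⟩ := (hT.2 k hk).1
  have := pos_of_harmonicMean_pos ((threshold_pos n σ ε).trans_le h1) ⟨0, hn⟩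
  rw [Nat.floor_pos] at this
  have hle : ∫ s in (T k)..(T (k + 1)), p ⟨0, hn⟩ s ≤ 0 := by
    rw [intervalIntegral.integral_symm, neg_nonpos]
    exact intervalIntegral.integral_nonneg hlt.le fun u hu => (hp _).nonneg u (h0.trans hu.1)
  linarith

/-- By time `T K` the server has completed at least `⌊K / 2⌋` rounds. -/
theorem exists_index_round {n : ℕ} (hn : 0 < n) {p : Fin n → ℝ → ℝ}
    (hp : ∀ i, IsComputePower (p i)) (A : Arrivals p) {σ ε : ℝ} {K : ℕ} {T : ℕ → ℝ}
    (hT : IsTimeSequence p σ ε K T) :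
    ∃ Q, (∀ q < Q, A.time q ≤ ENNReal.ofReal (T K)) ∧
      K / 2 ≤ (schedule (threshold n σ ε) A.worker Q).round := by
  have hnonneg : ∀ k ≤ K, 0 ≤ T k := by
    intro k hk
    cases k with
    | zero => exact hT.1.ge
    | succ k => exact (hT.2 k hk).1.1
  have hex : ∀ k, ∃ Q, k ≤ K → (∀ q, q < Q ↔ A.time q ≤ ENNReal.ofReal (T k)) ∧
      ∀ i, arrivalCount A.worker i Q = ⌊∫ s in (0 : ℝ)..(T k), p i s⌋₊ := by
    intro k
    by_cases hk : k ≤ K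
    · obtain ⟨Q, hQ⟩ := A.exists_index (hnonneg k hk)
      exact ⟨Q, fun _ => hQ⟩
    · exact ⟨0, fun h => absurd h hk⟩
  choose idx hidx using hex
  have hprog := le_progress (threshold n σ ε) A.worker hn (threshold_pos n σ ε) (K := K) idx
    (fun k i => ⌊∫ s in (T k)..(T (k + 1)), p i s⌋₊) (fun k hk => ?_)
    (fun k hk => (hT.2 k hk).1.2) (fun k hk i => ?_) K le_rfl
  · refine ⟨idx K, fun q hq => ((hidx K le_rfl).1 q).1 hq, ?_⟩
    rw [progress] at hprog
    split_ifs at hprog <;> omega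
  · by_contra! hlt
    have h1 := ((hidx k hk.le).1 _).1 hlt
    have h2 := h1.trans (ENNReal.ofReal_le_ofReal (hT.le_succ hn hp hk))
    exact lt_irrefl _ (((hidx (k + 1) hk).1 _).2 h2)
  · rw [(hidx k hk.le).2, (hidx (k + 1) hk).2]
    exact floor_add_floor_le (hp i) (hnonneg k hk.le) (hT.le_succ hn hp hk)

/-! ### Gradients and smoothness -/

theorem gradient_eq_sum {d : ℕ} (f : Vec d → ℝ) (x : Vec d) :
    gradient f x = ∑ k, (fderiv ℝ f x (EuclideanSpace.basisFun (Fin d) ℝ k)) •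
      EuclideanSpace.basisFun (Fin d) ℝ k := by
  conv_lhs => rw [← (EuclideanSpace.basisFun (Fin d) ℝ).sum_repr (gradient f x)]
  refine Finset.sum_congr rfl fun k _ => ?_
  rw [OrthonormalBasis.repr_apply_apply, real_inner_comm, inner_gradient_left]

/-- Along the segment from `x` to `x + v` the derivative of `f` is at most that of the quadratic,
and the two start at the same value. -/
theorem le_quadratic_of_gradient_lipschitz {d : ℕ} {f : Vec d → ℝ} (hf : Differentiable ℝ f)
    {L : ℝ} (hlip : ∀ x y, ‖gradient f x - gradient f y‖ ≤ L * ‖x - y‖) (x v : Vec d) :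
    f (x + v) ≤ f x + inner ℝ (gradient f x) v + L / 2 * ‖v‖ ^ 2 := by
  have hderiv : ∀ t : ℝ, HasDerivAt (fun t : ℝ => f (x + t • v))
      (inner ℝ (gradient f (x + t • v)) v) t := by
    intro t
    have h1 : HasDerivAt (fun t : ℝ => x + t • v) v t := by
      simpa using ((hasDerivAt_id t).smul_const v).const_add x
    have h2 := (hf (x + t • v)).hasFDerivAt.comp_hasDerivAt t h1
    rw [inner_gradient_left]
    exact h2
  have hB : ∀ t : ℝ, HasDerivAt
      (fun t : ℝ => f x + t * inner ℝ (gradient f x) v + L / 2 * t ^ 2 * ‖v‖ ^ 2)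
      (inner ℝ (gradient f x) v + L * t * ‖v‖ ^ 2) t := by
    intro t
    have h1 := ((hasDerivAt_id t).mul_const (inner ℝ (gradient f x) v)).const_add (f x)
    have h2 := (((hasDerivAt_id t).pow 2).const_mul (L / 2)).mul_const (‖v‖ ^ 2)
    refine (h1.add h2).congr_deriv ?_
    simp only [id_eq, Nat.cast_ofNat, Nat.reduceSub, pow_one]
    ring
  have := image_le_of_deriv_right_le_deriv_boundary (a := 0) (b := 1)
    (fun t _ => (hderiv t).continuousAt.continuousWithinAt)
    (fun t _ => (hderiv t).hasDerivWithinAt) (B := fun t : ℝ =>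
      f x + t * inner ℝ (gradient f x) v + L / 2 * t ^ 2 * ‖v‖ ^ 2) (by simp)
    (fun t _ => (hB t).continuousAt.continuousWithinAt)
    (fun t _ => (hB t).hasDerivWithinAt) (fun t ht => ?_) (x := 1) (by simp)
  · simpa using this
  · have h1 : inner ℝ (gradient f (x + t • v)) v =
        inner ℝ (gradient f x) v + inner ℝ (gradient f (x + t • v) - gradient f x) v := by
      rw [inner_sub_left]; ring
    rw [h1]
    have h2 := real_inner_le_norm (gradient f (x + t • v) - gradient f x) v
    have h3 := hlip (x + t • v) x
    rw [add_sub_cancel_left, norm_smul, Real.norm_of_nonneg ht.1] at h3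
    nlinarith [norm_nonneg v]

/-- At a point where an `L`-smooth function is close to its infimum its gradient is small. -/
theorem norm_gradient_sq_le {d : ℕ} {f : Vec d → ℝ} (hf : Differentiable ℝ f)
    {L : ℝ} (hL : 0 < L) (hlip : ∀ x y, ‖gradient f x - gradient f y‖ ≤ L * ‖x - y‖)
    {m : ℝ} (hm : ∀ x, m ≤ f x) (x : Vec d) :
    ‖gradient f x‖ ^ 2 ≤ 2 * L * (f x - m) := by
  -- The step `-∇f(x)/L` minimizes the quadratic upper bound.
  have h := (hm _).trans (le_quadratic_of_gradient_lipschitz hf hlip x (-(1 / L) • gradient f x))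
  rw [inner_smul_right, real_inner_self_eq_norm_sq, norm_smul, mul_pow, norm_neg,
    Real.norm_of_nonneg (by positivity)] at h
  have h2 : -(1 / L) * ‖gradient f x‖ ^ 2 + L / 2 * ((1 / L) ^ 2 * ‖gradient f x‖ ^ 2) =
      -(‖gradient f x‖ ^ 2 / (2 * L)) := by
    field_simp; ring
  have h3 : ‖gradient f x‖ ^ 2 / (2 * L) ≤ f x - m := by linarith
  rw [div_le_iff₀ (by positivity)] at h3
  linarith

section Objective

variable {d n : ℕ} {Ξ : Fin n → Type*} [∀ i, MeasurableSpace (Ξ i)]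
  {F : ∀ i, Vec d → Ξ i → ℝ} {D : ∀ i, Measure (Ξ i)} {L σ : ℝ}

theorem GeneralizedSmooth.hasGradientAt (h : GeneralizedSmooth F D L) (x : Vec d) :
    HasGradientAt (objective F D)
      ((1 / (n : ℝ)) • ∑ i, gradient (localObjective F D i) x) x := by
  rw [hasGradientAt_iff_hasFDerivAt, map_smul, map_sum]
  have h1 : HasFDerivAt (fun x => ∑ i, localObjective F D i x)
      (∑ i, InnerProductSpace.toDual ℝ (Vec d) (gradient (localObjective F D i) x)) x :=
    HasFDerivAt.fun_sum fun i _ => ((h.differentiable i) x).hasGradientAt.hasFDerivAt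
  exact h1.const_mul (1 / (n : ℝ))

theorem GeneralizedSmooth.gradient_objective (h : GeneralizedSmooth F D L) (x : Vec d) :
    gradient (objective F D) x = (1 / (n : ℝ)) • ∑ i, gradient (localObjective F D i) x :=
  (h.hasGradientAt x).gradient

theorem GeneralizedSmooth.differentiable_objective (h : GeneralizedSmooth F D L) :
    Differentiable ℝ (objective F D) :=
  fun x => (h.hasGradientAt x).differentiableAt

theorem GeneralizedSmooth.lipschitz_objective (h : GeneralizedSmooth F D L) (hn : 0 < n)
    (hL : 0 < L) (x y : Vec d) :
    ‖gradient (objective F D) x - gradient (objective F D) y‖ ≤ L * ‖x - y‖ := by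
  have h1 := h.smooth x fun _ => y
  have hn' : (n : ℝ) ≠ 0 := by exact_mod_cast hn.ne'
  rw [← h.gradient_objective, Finset.sum_const, Finset.card_univ, Fintype.card_fin,
    nsmul_eq_mul] at h1
  have h2 : L ^ 2 / n * (n * ‖x - y‖ ^ 2) = (L * ‖x - y‖) ^ 2 := by field_simp
  rw [h2] at h1
  exact le_of_sq_le_sq h1 (by positivity)

/-- Moving a single `y i` away from `x` isolates one local gradient. The constant is crude (`√n L`
would do); it serves measurability and integrability only. -/
theorem GeneralizedSmooth.lipschitz_local (h : GeneralizedSmooth F D L) (hn : 0 < n)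
    (hL : 0 < L) (i : Fin n) (x y : Vec d) :
    ‖gradient (localObjective F D i) x - gradient (localObjective F D i) y‖ ≤
      n * L * ‖x - y‖ := by
  have h1 := h.smooth x (Function.update (fun _ => x) i y)
  have hn1 : (1 : ℝ) ≤ n := by exact_mod_cast hn
  rw [h.gradient_objective, ← smul_sub, ← Finset.sum_sub_distrib,
    Finset.sum_eq_single i (fun j _ hj => by simp [hj]) (by simp),
    Finset.sum_eq_single i (fun j _ hj => by simp [hj]) (by simp), norm_smul, mul_pow,
    Function.update_self, Real.norm_of_nonneg (by positivity)] at h1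
  have h2 : L ^ 2 / n * ‖x - y‖ ^ 2 ≤ L ^ 2 * ‖x - y‖ ^ 2 := by
    gcongr
    exact div_le_self (by positivity) hn1
  have h3 := h1.trans h2
  rw [one_div, inv_pow, inv_mul_le_iff₀ (by positivity)] at h3
  refine le_of_sq_le_sq (h3.trans_eq (by ring)) (by positivity)

/-- Joint measurability is needed to insert a random model. The loss is continuous in `x` and
measurable in `ξ`, hence jointly measurable, and partial derivatives are limits of difference
quotients. -/
theorem UnbiasedBoundedVariance.measurable_stochGrad (h : UnbiasedBoundedVariance F D σ)
    (i : Fin n) : Measurable fun z : Vec d × Ξ i => stochGrad F i z.1 z.2 := by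
  have hF : Measurable fun z : Vec d × Ξ i => F i z.1 z.2 :=
    measurable_uncurry_of_continuous_of_measurable
      (fun ξ => (h.differentiable_loss i ξ).continuous) (h.measurable_loss i)
  simp only [stochGrad, gradient_eq_sum]
  refine Finset.measurable_fun_sum _ fun k _ => (Measurable.smul_const (f := fun z : Vec d × Ξ i =>
    fderiv ℝ (fun y => F i y z.2) z.1 (EuclideanSpace.basisFun (Fin d) ℝ k)) ?_ _)
  set v := EuclideanSpace.basisFun (Fin d) ℝ k
  refine measurable_of_tendsto_metrizable (f := fun (m : ℕ) (z : Vec d × Ξ i) =>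
    (m : ℝ) • (F i (z.1 + (m : ℝ)⁻¹ • v) z.2 - F i z.1 z.2)) (fun m => ?_) ?_
  · refine Measurable.const_mul (Measurable.sub ?_ hF) (m : ℝ)
    exact hF.comp ((measurable_fst.add_const _).prodMk measurable_snd)
  · rw [tendsto_pi_nhds]
    intro z
    exact (((h.differentiable_loss i z.2) z.1).hasFDerivAt.lim_real v).comp
      tendsto_natCast_atTop_atTop

end Objective

/-! ### Square-integrable random vectors -/

section SqIntegrable

variable {d : ℕ} {Ω : Type*}

/-- `X` is a square-integrable random vector that is measurable for the sub-σ-algebra `m`. -/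
structure SqIntegrable (m : MeasurableSpace Ω) [mΩ : MeasurableSpace Ω] (μ : Measure Ω) (X : Ω → Vec d) : Prop where
  measurable : Measurable[m] X
  memLp : MemLp X 2 μ

variable {m m' : MeasurableSpace Ω} [mΩ : MeasurableSpace Ω] {μ : Measure Ω} {X Y : Ω → Vec d}

theorem SqIntegrable.mono (hX : SqIntegrable m μ X) (h : m ≤ m') :
    SqIntegrable m' μ X := ⟨hX.measurable.mono h le_rfl, hX.memLp⟩

theorem SqIntegrable.add (hX : SqIntegrable m μ X) (hY : SqIntegrable m μ Y) :
    SqIntegrable m μ fun ω => X ω + Y ω :=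
  ⟨hX.measurable.add hY.measurable, hX.memLp.add hY.memLp⟩

theorem SqIntegrable.sub (hX : SqIntegrable m μ X) (hY : SqIntegrable m μ Y) :
    SqIntegrable m μ fun ω => X ω - Y ω :=
  ⟨hX.measurable.sub hY.measurable, hX.memLp.sub hY.memLp⟩

theorem SqIntegrable.const_smul (hX : SqIntegrable m μ X) (c : ℝ) :
    SqIntegrable m μ fun ω => c • X ω :=
  ⟨hX.measurable.const_smul c, hX.memLp.const_smul c⟩

theorem SqIntegrable.sum {ι : Type*} {s : Finset ι} {X : ι → Ω → Vec d}
    (hX : ∀ i ∈ s, SqIntegrable m μ (X i)) : SqIntegrable m μ fun ω => ∑ i ∈ s, X i ω :=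
  ⟨Finset.measurable_fun_sum _ fun i hi => (hX i hi).measurable,
    memLp_finsetSum _ fun i hi => (hX i hi).memLp⟩

theorem SqIntegrable.const [IsFiniteMeasure μ] (c : Vec d) :
    SqIntegrable m μ fun _ => c := ⟨measurable_const, memLp_const c⟩

theorem SqIntegrable.comp_lipschitz [IsFiniteMeasure μ] {g : Vec d → Vec d} {C : ℝ}
    (hg : ∀ x y, ‖g x - g y‖ ≤ C * ‖x - y‖) (hX : SqIntegrable m μ X) :
    SqIntegrable m μ fun ω => g (X ω) := by
  have hcont : Continuous g := by
    refine (LipschitzWith.of_dist_le_mul (K := ⟨|C|, abs_nonneg C⟩) fun x y => ?_).continuous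
    rw [dist_eq_norm, dist_eq_norm]
    exact (hg x y).trans (mul_le_mul_of_nonneg_right (le_abs_self C) (norm_nonneg _))
  have h1 : MemLp (fun ω => g (X ω) - g 0) 2 μ := by
    refine MemLp.of_le_mul (c := C) hX.memLp ?_ (Filter.Eventually.of_forall fun ω => ?_)
    · exact (hcont.sub continuous_const).comp_aestronglyMeasurable hX.memLp.1
    · simpa using hg (X ω) 0
  refine ⟨hcont.measurable.comp hX.measurable, ?_⟩
  have h2 : (fun ω => g (X ω)) = fun ω => (g (X ω) - g 0) + g 0 := by ext1 ω; simp
  rw [h2]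
  exact h1.add (memLp_const (g 0))

theorem integrable_inner_of_memLp (hX : MemLp X 2 μ) (hY : MemLp Y 2 μ) :
    Integrable (fun ω => inner ℝ (X ω) (Y ω)) μ := by
  refine Integrable.mono' (hX.norm.integrable_mul hY.norm) (hX.1.inner hY.1)
    (Filter.Eventually.of_forall fun ω => ?_)
  exact norm_inner_le_norm _ _

theorem integrable_norm_sq_of_memLp (hX : MemLp X 2 μ) : Integrable (fun ω => ‖X ω‖ ^ 2) μ :=
  (memLp_two_iff_integrable_sq_norm hX.1).1 hX

/-- The function lies between the constant `c` and a quadratic. -/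
theorem integrable_comp_of_smooth [IsProbabilityMeasure μ] {f : Vec d → ℝ}
    (hf : Differentiable ℝ f)
    {L : ℝ} (hlip : ∀ x y, ‖gradient f x - gradient f y‖ ≤ L * ‖x - y‖)
    {c : ℝ} (hc : ∀ x, c ≤ f x) (hX : MemLp X 2 μ) : Integrable (fun ω => f (X ω)) μ := by
  have hint : Integrable (fun ω => |c| + (|f 0| + ‖gradient f 0‖ * ‖X ω‖ +
      |L| / 2 * ‖X ω‖ ^ 2)) μ := by
    refine (integrable_const _).add (((integrable_const _).add ?_).add ?_)
    · exact ((hX.norm.integrable (by norm_num)).const_mul _)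
    · exact (integrable_norm_sq_of_memLp hX).const_mul _
  refine hint.mono' (hf.continuous.comp_aestronglyMeasurable hX.1)
    (Filter.Eventually.of_forall fun ω => ?_)
  have h1 := le_quadratic_of_gradient_lipschitz hf hlip 0 (X ω)
  rw [zero_add] at h1
  have h2 := real_inner_le_norm (gradient f 0) (X ω)
  have h3 : L / 2 * ‖X ω‖ ^ 2 ≤ |L| / 2 * ‖X ω‖ ^ 2 := by
    gcongr
    exact le_abs_self L
  have h4 := hc (X ω)
  have h5 := neg_abs_le c
  have h6 := le_abs_self (f 0)
  have h7 : 0 ≤ |L| / 2 * ‖X ω‖ ^ 2 := by positivity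
  have h8 : 0 ≤ ‖gradient f 0‖ * ‖X ω‖ := by positivity
  rw [Real.norm_eq_abs, abs_le]
  constructor <;> linarith [abs_nonneg c, abs_nonneg (f 0)]

end SqIntegrable

/-! ### The error of a stochastic gradient -/

section Noise

variable {d n : ℕ} {Ξ : Fin n → Type*} [∀ i, MeasurableSpace (Ξ i)]
  {F : ∀ i, Vec d → Ξ i → ℝ} {D : ∀ i, Measure (Ξ i)} [∀ i, IsProbabilityMeasure (D i)]
  {L σ : ℝ} {Ω : Type*} [mΩ : MeasurableSpace Ω] {μ : Measure Ω} [IsProbabilityMeasure μ]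

/-- The error of the stochastic gradient. -/
def gradError (F : ∀ i, Vec d → Ξ i → ℝ) (D : ∀ i, Measure (Ξ i)) (i : Fin n) (x : Vec d)
    (ξ : Ξ i) : Vec d :=
  stochGrad F i x ξ - gradient (localObjective F D i) x

omit [∀ i, IsProbabilityMeasure (D i)] in
theorem gradError_eq (i : Fin n) (x : Vec d) (ξ : Ξ i) :
    gradError F D i x ξ = stochGrad F i x ξ - gradient (localObjective F D i) x := rfl

attribute [irreducible] gradError

variable (hstoch : UnbiasedBoundedVariance F D σ) (hsmooth : GeneralizedSmooth F D L)
  (hn : 0 < n) (hL : 0 < L) {i : Fin n} {ζ : Ω → Ξ i} (hζ : Measurable ζ) (hlaw : μ.map ζ = D i)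

omit [∀ i, IsProbabilityMeasure (D i)] in
theorem GeneralizedSmooth.continuous_gradient_local (hsmooth : GeneralizedSmooth F D L)
    (hn : 0 < n) (hL : 0 < L) (i : Fin n) :
    Continuous (gradient (localObjective F D i)) := by
  refine (LipschitzWith.of_dist_le_mul (K := ⟨n * L, by positivity⟩) fun x y => ?_).continuous
  rw [dist_eq_norm, dist_eq_norm]
  exact hsmooth.lipschitz_local hn hL i x y

omit [∀ i, IsProbabilityMeasure (D i)] in
include hstoch hsmooth hn hL in
theorem measurable_gradError (i : Fin n) :
    Measurable fun z : Vec d × Ξ i => gradError F D i z.1 z.2 := by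
  simp only [gradError_eq]
  exact (hstoch.measurable_stochGrad i).sub
    ((hsmooth.continuous_gradient_local hn hL i).measurable.comp measurable_fst)

include hstoch hsmooth hn hL hζ hlaw in
/-- If the sample is independent of the point, then the error of the stochastic gradient has
second moment at most `σ²`. -/
theorem memLp_gradError {Y : Ω → Vec d} (hY : Measurable Y) (hind : IndepFun Y ζ μ) :
    MemLp (fun ω => gradError F D i (Y ω) (ζ ω)) 2 μ ∧
      ∫ ω, ‖gradError F D i (Y ω) (ζ ω)‖ ^ 2 ∂μ ≤ σ ^ 2 := by
  have hmeas := measurable_gradError hstoch hsmooth hn hL i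
  have hmeas' : Measurable fun ω => gradError F D i (Y ω) (ζ ω) := hmeas.comp (hY.prodMk hζ)
  have hprob : IsProbabilityMeasure (μ.map Y) := Measure.isProbabilityMeasure_map hY.aemeasurable
  -- Independence makes the joint law a product, so the variance bound applies at each fixed point.
  -- The extended integral is used since integrability is itself a consequence of this bound.
  have hlint : ∫⁻ ω, ENNReal.ofReal (‖gradError F D i (Y ω) (ζ ω)‖ ^ 2) ∂μ ≤
      ENNReal.ofReal (σ ^ 2) := by
    have hm2 : Measurable fun z : Vec d × Ξ i =>
        ENNReal.ofReal (‖gradError F D i z.1 z.2‖ ^ 2) := (hmeas.norm.pow_const 2).ennreal_ofReal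
    have h1 : ∫⁻ ω, ENNReal.ofReal (‖gradError F D i (Y ω) (ζ ω)‖ ^ 2) ∂μ =
        ∫⁻ z, ENNReal.ofReal (‖gradError F D i z.1 z.2‖ ^ 2) ∂(μ.map fun ω => (Y ω, ζ ω)) :=
      (lintegral_map hm2 (hY.prodMk hζ)).symm
    rw [h1, (indepFun_iff_map_prod_eq_prod_map_map hY.aemeasurable hζ.aemeasurable).1 hind, hlaw,
      lintegral_prod _ hm2.aemeasurable]
    calc _ ≤ ∫⁻ _, ENNReal.ofReal (σ ^ 2) ∂(μ.map Y) := by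
          refine lintegral_mono fun y => ?_
          have := ofReal_integral_eq_lintegral_ofReal (hstoch.integrable_sq i y)
            (Filter.Eventually.of_forall fun ξ => by positivity)
          simp only [gradError_eq]
          rw [← this]
          exact ENNReal.ofReal_le_ofReal (hstoch.variance_le i y)
      _ = ENNReal.ofReal (σ ^ 2) := by simp
  have hint : Integrable (fun ω => ‖gradError F D i (Y ω) (ζ ω)‖ ^ 2) μ := by
    refine ⟨(hmeas'.norm.pow_const 2).aestronglyMeasurable, ?_⟩
    rw [hasFiniteIntegral_iff_ofReal (Filter.Eventually.of_forall fun ω => by positivity)]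
    exact hlint.trans_lt ENNReal.ofReal_lt_top
  refine ⟨(memLp_two_iff_integrable_sq_norm hmeas'.aestronglyMeasurable).2 hint, ?_⟩
  rw [integral_eq_lintegral_of_nonneg_ae (Filter.Eventually.of_forall fun ω => by positivity)
    hint.1]
  exact ENNReal.toReal_le_of_le_ofReal (by positivity) hlint

include hstoch hsmooth hn hL hζ hlaw in
/-- If the sample is independent of the point and of `V`, then the error of the stochastic
gradient is orthogonal to `V`. -/
theorem integral_inner_gradError {V Y : Ω → Vec d} (hV : Measurable V) (hV2 : MemLp V 2 μ)
    (hY : Measurable Y) (hind : IndepFun (fun ω => (V ω, Y ω)) ζ μ) :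
    ∫ ω, inner ℝ (V ω) (gradError F D i (Y ω) (ζ ω)) ∂μ = 0 := by
  have hmeas := measurable_gradError hstoch hsmooth hn hL i
  have hVY : Measurable fun ω => (V ω, Y ω) := hV.prodMk hY
  have hprob : IsProbabilityMeasure (μ.map fun ω => (V ω, Y ω)) :=
    Measure.isProbabilityMeasure_map hVY.aemeasurable
  have hindY : IndepFun Y ζ μ := hind.comp measurable_snd measurable_id
  have hmem := (memLp_gradError hstoch hsmooth hn hL hζ hlaw hY hindY).1
  have hint := integrable_inner_of_memLp hV2 hmem
  have hm2 : Measurable fun z : (Vec d × Vec d) × Ξ i =>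
      inner ℝ z.1.1 (gradError F D i z.1.2 z.2) :=
    measurable_fst.fst.inner
      (hmeas.comp (measurable_fst.snd.prodMk measurable_snd))
  have hjoint := (indepFun_iff_map_prod_eq_prod_map_map hVY.aemeasurable hζ.aemeasurable).1 hind
  rw [hlaw] at hjoint
  have hint2 : Integrable (fun z : (Vec d × Vec d) × Ξ i =>
      inner ℝ z.1.1 (gradError F D i z.1.2 z.2)) ((μ.map fun ω => (V ω, Y ω)).prod (D i)) := by
    rw [← hjoint]
    exact (integrable_map_measure hm2.aestronglyMeasurable (hVY.prodMk hζ).aemeasurable).2 hint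
  have h1 : ∫ ω, inner ℝ (V ω) (gradError F D i (Y ω) (ζ ω)) ∂μ =
      ∫ z, inner ℝ z.1.1 (gradError F D i z.1.2 z.2) ∂(μ.map fun ω => ((V ω, Y ω), ζ ω)) :=
    (integral_map (hVY.prodMk hζ).aemeasurable hm2.aestronglyMeasurable).symm
  -- For fixed `V` and `Y` the inner integral vanishes by unbiasedness.
  rw [h1, hjoint, integral_prod _ hint2]
  refine integral_eq_zero_of_ae (Filter.Eventually.of_forall fun z => ?_)
  have h2 : Integrable (fun ξ => gradError F D i z.2 ξ) (D i) := by
    simp only [gradError_eq]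
    exact (hstoch.integrable_grad i z.2).sub (integrable_const _)
  simp only [Pi.zero_apply]
  rw [integral_inner h2]
  simp only [gradError_eq]
  rw [integral_sub (hstoch.integrable_grad i z.2) (integrable_const _), hstoch.unbiased]
  simp

end Noise

/-! ### Measurability and integrability of the iterates -/

/-- The arrival number `q` delivers this gradient, given by its worker and its number among the
gradients of the worker. -/
def label {n : ℕ} (worker : ℕ → Fin n) (q : ℕ) : Fin n × ℕ :=
  (worker q, arrivalCount worker (worker q) q)

theorem arrivalCount_mono {n : ℕ} (worker : ℕ → Fin n) (i : Fin n) :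
    Monotone (arrivalCount worker i) :=
  monotone_nat_of_le_succ fun q => by rw [arrivalCount_succ]; exact Nat.le_add_right _ _

/-- No sample is used twice: this is what makes each new sample independent of those used by other
arrivals. -/
theorem label_injective {n : ℕ} (worker : ℕ → Fin n) : Function.Injective (label worker) := by
  intro q r h
  wlog hqr : q < r generalizing q r
  · by_contra hne
    exact hqr (by
      rcases lt_trichotomy q r with h1 | h1 | h1
      · exact h1
      · exact absurd h1 hne
      · exact absurd (this h.symm h1).symm hne)
  rw [label, label, Prod.mk.injEq] at h
  have h1 := arrivalCount_mono worker (worker r) (Nat.succ_le_of_lt hqr)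
  rw [Nat.succ_eq_add_one, arrivalCount_succ, if_pos h.1] at h1
  have h2 := h.2
  rw [h.1] at h2
  omega

section

variable {d n : ℕ} {Ξ : Fin n → Type*} [∀ i, MeasurableSpace (Ξ i)]
  (F : ∀ i, Vec d → Ξ i → ℝ) (D : ∀ i, Measure (Ξ i)) [∀ i, IsProbabilityMeasure (D i)]
  {Ω : Type*} [mΩ : MeasurableSpace Ω] (μ : Measure Ω) [IsProbabilityMeasure μ]
  (ξ : ∀ i, ℕ → Ω → Ξ i) (L σ γ thr : ℝ) (x₀ : Vec d) (worker : ℕ → Fin n)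

/-- The σ-algebra generated by the samples with a label in `S`. -/
@[reducible] def sampleSigma (S : Set (Fin n × ℕ)) : MeasurableSpace Ω :=
  ⨆ a ∈ S, MeasurableSpace.comap (ξ a.1 a.2) inferInstance

/-- The labels of the samples used in the tables of the rounds before round `t`. -/
def pastLabels (t : ℕ) : Set (Fin n × ℕ) :=
  {a | ∃ q, tableRound thr worker q < t ∧ label worker q = a}

/-- The assumptions of the theorem on the problem and on the samples. -/
structure Sampling : Prop where
  pos : 0 < n
  L_pos : 0 < L
  thr_pos : 0 < thr
  stoch : UnbiasedBoundedVariance F D σ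
  smooth : GeneralizedSmooth F D L
  meas : ∀ i m, Measurable (ξ i m)
  law : ∀ i m, μ.map (ξ i m) = D i
  indep : iIndepFun (fun (a : Fin n × ℕ) => ξ a.1 a.2) μ

omit mΩ in
theorem sampleSigma_mono {S T : Set (Fin n × ℕ)} (h : S ⊆ T) :
    sampleSigma ξ S ≤ sampleSigma ξ T := biSup_mono h

theorem pastLabels_mono {s t : ℕ} (h : s ≤ t) :
    pastLabels thr worker s ⊆ pastLabels thr worker t :=
  fun _ ⟨q, hq, ha⟩ => ⟨q, hq.trans_le h, ha⟩

omit mΩ in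
theorem measurable_sample {S : Set (Fin n × ℕ)} {a : Fin n × ℕ} (h : a ∈ S) :
    Measurable[sampleSigma ξ S] (ξ a.1 a.2) := by
  have : MeasurableSpace.comap (ξ a.1 a.2) inferInstance ≤ sampleSigma ξ S :=
    le_biSup (fun a : Fin n × ℕ => MeasurableSpace.comap (ξ a.1 a.2) inferInstance) h
  exact Measurable.of_comap_le this

variable {F D μ ξ L σ thr}

omit [∀ i, IsProbabilityMeasure (D i)] [IsProbabilityMeasure μ] in
theorem Sampling.sampleSigma_le (h : Sampling F D μ ξ L σ thr) (S : Set (Fin n × ℕ)) :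
    sampleSigma ξ S ≤ mΩ :=
  iSup₂_le fun a _ => (h.meas a.1 a.2).comap_le

omit [∀ i, IsProbabilityMeasure (D i)] [IsProbabilityMeasure μ] in
theorem Sampling.indepFun (h : Sampling F D μ ξ L σ thr) {S : Set (Fin n × ℕ)} {a : Fin n × ℕ}
    (ha : a ∉ S) {β : Type*} [MeasurableSpace β] {X : Ω → β}
    (hX : Measurable[sampleSigma ξ S] X) : IndepFun X (ξ a.1 a.2) μ := by
  have h1 := indep_iSup_of_disjoint (m := fun a : Fin n × ℕ =>
    MeasurableSpace.comap (ξ a.1 a.2) inferInstance) (fun a => (h.meas a.1 a.2).comap_le)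
    h.indep (S := S) (T := {a}) (Set.disjoint_singleton_right.2 ha)
  rw [IndepFun_iff_Indep]
  refine indep_of_indep_of_le_left (indep_of_indep_of_le_right h1 ?_) hX.comap_le
  simp

variable (F ξ thr)

/-- The model after `q` arrivals. -/
def iterate (q : ℕ) (ω : Ω) : Vec d := (run F γ thr x₀ (fun i m => ξ i m ω) worker q).x

/-- The model of worker `i` after `q` arrivals. -/
def workerModel (q : ℕ) (i : Fin n) (ω : Ω) : Vec d :=
  (run F γ thr x₀ (fun i m => ξ i m ω) worker q).model i

/-- The stochastic gradient delivered by arrival `q`. -/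
def arrival (q : ℕ) (ω : Ω) : Vec d := arrivedGrad F γ thr x₀ (fun i m => ξ i m ω) worker q

variable (D)

/-- The error of the stochastic gradient delivered by arrival `q`. -/
def arrivalError (q : ℕ) (ω : Ω) : Vec d :=
  gradError F D (worker q) (workerModel F ξ γ thr x₀ worker q (worker q) ω)
    (ξ (worker q) (arrivalCount worker (worker q) q) ω)

omit [∀ i, IsProbabilityMeasure (D i)] mΩ in
theorem arrival_eq (q : ℕ) (ω : Ω) :
    arrival F ξ γ thr x₀ worker q ω =
      gradient (localObjective F D (worker q))
        (workerModel F ξ γ thr x₀ worker q (worker q) ω) +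
      arrivalError F D ξ γ thr x₀ worker q ω := by
  rw [arrivalError, gradError_eq]
  simp only [arrival, arrivedGrad, workerModel]
  abel

/-! ### Errors as orthogonal increments of the filtration by rounds -/

variable {F D ξ thr}

/-- Only one sample is added to the past of the round. This sharp σ-algebra is what later makes two
errors of the same round orthogonal. -/
theorem Sampling.sqIntegrable_error (h : Sampling F D μ ξ L σ thr) {q : ℕ}
    (hq : SqIntegrable (sampleSigma ξ (pastLabels thr worker (tableRound thr worker q))) μ
      (workerModel F ξ γ thr x₀ worker q (worker q))) :
    SqIntegrable (sampleSigma ξ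
      (insert (label worker q) (pastLabels thr worker (tableRound thr worker q)))) μ
      (arrivalError F D ξ γ thr x₀ worker q) ∧
    ∫ ω, ‖arrivalError F D ξ γ thr x₀ worker q ω‖ ^ 2 ∂μ ≤ σ ^ 2 := by
  have hnot : label worker q ∉ pastLabels thr worker (tableRound thr worker q) := by
    rintro ⟨r, hr, hl⟩
    rw [label_injective worker hl] at hr
    exact lt_irrefl _ hr
  have hind := h.indepFun hnot hq.measurable
  have hmem := memLp_gradError h.stoch h.smooth h.pos h.L_pos (h.meas _ _) (h.law _ _)
    (hq.measurable.mono (h.sampleSigma_le _) le_rfl) hind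
  refine ⟨⟨?_, hmem.1⟩, hmem.2⟩
  refine (measurable_gradError h.stoch h.smooth h.pos h.L_pos (worker q)).comp
    (Measurable.prodMk ?_ ?_)
  · exact hq.measurable.mono (sampleSigma_mono ξ (Set.subset_insert _ _)) le_rfl
  · exact measurable_sample ξ (a := label worker q) (Set.mem_insert _ _)

theorem Sampling.sqIntegrable_arrival (h : Sampling F D μ ξ L σ thr) {q : ℕ}
    (hq : SqIntegrable (sampleSigma ξ (pastLabels thr worker (tableRound thr worker q))) μ
      (workerModel F ξ γ thr x₀ worker q (worker q))) :
    SqIntegrable (sampleSigma ξ (pastLabels thr worker (tableRound thr worker q + 1))) μ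
      (arrival F ξ γ thr x₀ worker q) := by
  have h1 : arrival F ξ γ thr x₀ worker q = fun ω =>
      gradient (localObjective F D (worker q))
        (workerModel F ξ γ thr x₀ worker q (worker q) ω) +
      arrivalError F D ξ γ thr x₀ worker q ω := funext (arrival_eq F D ξ γ thr x₀ worker q)
  rw [h1]
  refine ((hq.comp_lipschitz (h.smooth.lipschitz_local h.pos h.L_pos (worker q))).mono ?_).add
    ((h.sqIntegrable_error γ x₀ worker hq).1.mono ?_)
  · exact sampleSigma_mono ξ (pastLabels_mono thr worker (Nat.le_succ _))
  · refine sampleSigma_mono ξ (Set.insert_subset ?_ ?_)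
    · exact ⟨q, Nat.lt_succ_self _, rfl⟩
    · exact pastLabels_mono thr worker (Nat.le_succ _)

omit [∀ i, MeasurableSpace (Ξ i)] mΩ in
theorem iterate_succ_of_not_descends (hn : 0 < n) (hthr : 0 < thr) {q : ℕ}
    (hd : ¬ DescendsAt thr worker q) :
    iterate F ξ γ thr x₀ worker (q + 1) = iterate F ξ γ thr x₀ worker q ∧
      workerModel F ξ γ thr x₀ worker (q + 1) = workerModel F ξ γ thr x₀ worker q := by
  refine ⟨funext fun ω => ?_, funext fun i => funext fun ω => ?_⟩
  · exact (run_succ_of_not_descends F γ thr x₀ _ worker hn hthr hd).1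
  · exact congrFun (run_succ_of_not_descends F γ thr x₀ _ worker hn hthr hd).2 i

omit [∀ i, MeasurableSpace (Ξ i)] mΩ in
theorem iterate_succ_of_descends (hn : 0 < n) (hthr : 0 < thr) {q : ℕ}
    (hd : DescendsAt thr worker q) :
    iterate F ξ γ thr x₀ worker (q + 1) = (fun ω => iterate F ξ γ thr x₀ worker q ω -
      γ • ((1 / (n : ℝ)) • ∑ i,
        ((table thr worker (schedule thr worker q).round i (q + 1)).card : ℝ)⁻¹ •
          ∑ r ∈ table thr worker (schedule thr worker q).round i (q + 1),
            arrival F ξ γ thr x₀ worker r ω)) ∧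
      workerModel F ξ γ thr x₀ worker (q + 1) =
        Function.update (workerModel F ξ γ thr x₀ worker q) (worker q)
          (iterate F ξ γ thr x₀ worker (q + 1)) := by
  refine ⟨funext fun ω => ?_, funext fun i => funext fun ω => ?_⟩
  · exact (run_succ_of_descends F γ thr x₀ _ worker hn hthr hd).1
  · refine (congrFun (run_succ_of_descends F γ thr x₀ _ worker hn hthr hd).2 i).trans ?_
    by_cases hi : i = worker q
    · subst hi; simp [iterate]
    · simp [hi, workerModel]

variable (thr) in
/-- The rounds whose samples influence the current model are those before this one. -/
def activeRound (q : ℕ) : ℕ :=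
  (schedule thr worker q).round + if (schedule thr worker q).updated = ∅ then 0 else 1

/-- The filtration is indexed by table rounds, not by time. A worker not yet updated still holds a
model from before the current round, so its gradient joins the current table; an updated worker
holds a model built from the current table, and its gradient is put aside for the next one. Either
way a gradient in the table of round `t` is taken at a model determined by earlier tables. -/
theorem Sampling.sqIntegrable_iterate (h : Sampling F D μ ξ L σ thr) (q : ℕ) :
    SqIntegrable (sampleSigma ξ (pastLabels thr worker (activeRound thr worker q))) μ
      (iterate F ξ γ thr x₀ worker q) ∧
    (∀ i, SqIntegrable (sampleSigma ξ (pastLabels thr worker (activeRound thr worker q))) μ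
      (workerModel F ξ γ thr x₀ worker q i)) ∧
    (∀ i ∉ (schedule thr worker q).updated,
      SqIntegrable (sampleSigma ξ (pastLabels thr worker (schedule thr worker q).round)) μ
        (workerModel F ξ γ thr x₀ worker q i)) ∧
    ∀ r < q, SqIntegrable
      (sampleSigma ξ (pastLabels thr worker (tableRound thr worker r))) μ
      (workerModel F ξ γ thr x₀ worker r (worker r)) := by
  induction q with
  | zero =>
    exact ⟨SqIntegrable.const x₀, fun _ => SqIntegrable.const x₀, fun _ _ => SqIntegrable.const x₀,
      fun r hr => absurd hr (Nat.not_lt_zero _)⟩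
  | succ q ih =>
    obtain ⟨ihx, ihm, ihu, ihr⟩ := ih
    have hcur : SqIntegrable (sampleSigma ξ (pastLabels thr worker (tableRound thr worker q))) μ
        (workerModel F ξ γ thr x₀ worker q (worker q)) := by
      by_cases hj : worker q ∈ (schedule thr worker q).updated
      · have := ihm (worker q)
        rwa [activeRound, if_neg (Finset.ne_empty_of_mem hj),
          ← tableRound_of_mem thr worker hj] at this
      · rw [tableRound_of_notMem thr worker hj]
        exact ihu _ hj
    have hr : ∀ r < q + 1, SqIntegrable
        (sampleSigma ξ (pastLabels thr worker (tableRound thr worker r))) μ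
        (workerModel F ξ γ thr x₀ worker r (worker r)) := by
      intro r hr
      rcases Nat.lt_succ_iff_lt_or_eq.1 hr with hr | rfl
      · exact ihr r hr
      · exact hcur
    by_cases hd : DescendsAt thr worker q
    · obtain ⟨hx, hm⟩ := iterate_succ_of_descends (F := F) (ξ := ξ) γ x₀ worker h.pos h.thr_pos hd
      set t := (schedule thr worker q).round with ht
      have hle : ∀ {s}, s ≤ t + 1 → sampleSigma ξ (pastLabels thr worker s) ≤
          sampleSigma ξ (pastLabels thr worker (t + 1)) :=
        fun hs => sampleSigma_mono ξ (pastLabels_mono thr worker hs)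
      have hact : activeRound thr worker q ≤ t + 1 := by
        rw [activeRound]; split_ifs <;> omega
      have hx1 : SqIntegrable (sampleSigma ξ (pastLabels thr worker (t + 1))) μ
          (iterate F ξ γ thr x₀ worker (q + 1)) := by
        rw [hx]
        refine (ihx.mono (hle hact)).sub (SqIntegrable.const_smul (SqIntegrable.const_smul
          (SqIntegrable.sum fun i _ => SqIntegrable.const_smul
            (SqIntegrable.sum fun r hrt => ?_) _) _) _)
        rw [mem_table] at hrt
        have := h.sqIntegrable_arrival γ x₀ worker (hr r hrt.1)
        rwa [hrt.2.2] at this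
      have hm1 : ∀ i, SqIntegrable (sampleSigma ξ (pastLabels thr worker (t + 1))) μ
          (workerModel F ξ γ thr x₀ worker (q + 1) i) := by
        intro i
        rw [hm]
        by_cases hi : i = worker q
        · subst hi
          rw [Function.update_self]
          exact hx1
        · rw [Function.update_of_ne hi]
          exact (ihm i).mono (hle hact)
      by_cases hl : insert (worker q) (schedule thr worker q).updated = Finset.univ
      · have hs : schedule thr worker (q + 1) = _ := Schedule.step_of_last hd hl
        rw [activeRound, hs]
        simp only [if_true, add_zero]
        exact ⟨hx1, hm1, fun i _ => hm1 i, hr⟩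
      · have hs : schedule thr worker (q + 1) = _ := Schedule.step_of_descends hd hl
        rw [activeRound, hs]
        simp only [Finset.insert_ne_empty, if_false]
        refine ⟨hx1, hm1, fun i hi => ?_, hr⟩
        rw [Finset.mem_insert, not_or] at hi
        rw [hm, Function.update_of_ne hi.1]
        exact ihu i hi.2
    · obtain ⟨hx, hm⟩ :=
        iterate_succ_of_not_descends (F := F) (ξ := ξ) γ x₀ worker h.pos h.thr_pos hd
      have hs : (schedule thr worker (q + 1)).round = (schedule thr worker q).round ∧
          (schedule thr worker (q + 1)).updated = (schedule thr worker q).updated := by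
        rw [schedule]
        by_cases hj : worker q ∈ (schedule thr worker q).updated
        · rw [Schedule.step_of_mem hj]
          exact ⟨rfl, rfl⟩
        · rw [Schedule.step_of_not_descends hj hd]
          exact ⟨rfl, rfl⟩
      rw [activeRound, hs.1, hs.2, hx, hm]
      exact ⟨ihx, ihm, ihu, hr⟩

theorem Sampling.sqIntegrable_model (h : Sampling F D μ ξ L σ thr) (q : ℕ) :
    SqIntegrable (sampleSigma ξ (pastLabels thr worker (tableRound thr worker q))) μ
      (workerModel F ξ γ thr x₀ worker q (worker q)) :=
  (h.sqIntegrable_iterate γ x₀ worker (q + 1)).2.2.2 q (Nat.lt_succ_self q)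

theorem Sampling.memLp_error (h : Sampling F D μ ξ L σ thr) (q : ℕ) :
    MemLp (arrivalError F D ξ γ thr x₀ worker q) 2 μ :=
  (h.sqIntegrable_error γ x₀ worker (h.sqIntegrable_model γ x₀ worker q)).1.memLp

/-- The set `S` contains the past of the model as well, so that `V` and the model are jointly
independent of the new sample. -/
theorem Sampling.integral_inner_error (h : Sampling F D μ ξ L σ thr) {q : ℕ}
    {S : Set (Fin n × ℕ)} (hS : pastLabels thr worker (tableRound thr worker q) ⊆ S)
    (hq : label worker q ∉ S) {V : Ω → Vec d} (hV : SqIntegrable (sampleSigma ξ S) μ V) :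
    ∫ ω, inner ℝ (V ω) (arrivalError F D ξ γ thr x₀ worker q ω) ∂μ = 0 := by
  have hY := (h.sqIntegrable_model γ x₀ worker q).mono (sampleSigma_mono ξ hS)
  exact integral_inner_gradError h.stoch h.smooth h.pos h.L_pos (h.meas _ _) (h.law _ _)
    (hV.measurable.mono (h.sampleSigma_le _) le_rfl) hV.memLp
    (hY.measurable.mono (h.sampleSigma_le _) le_rfl)
    (h.indepFun hq (hV.measurable.prodMk hY.measurable))

theorem Sampling.integral_inner_error_past (h : Sampling F D μ ξ L σ thr) {q : ℕ}
    {V : Ω → Vec d}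
    (hV : SqIntegrable (sampleSigma ξ (pastLabels thr worker (tableRound thr worker q))) μ V) :
    ∫ ω, inner ℝ (V ω) (arrivalError F D ξ γ thr x₀ worker q ω) ∂μ = 0 := by
  refine h.integral_inner_error γ x₀ worker subset_rfl ?_ hV
  rintro ⟨r, hr, hl⟩
  rw [label_injective worker hl] at hr
  exact lt_irrefl _ hr

theorem Sampling.integral_inner_error_error (h : Sampling F D μ ξ L σ thr) {q r : ℕ}
    (hqr : q ≠ r) (ht : tableRound thr worker q = tableRound thr worker r) :
    ∫ ω, inner ℝ (arrivalError F D ξ γ thr x₀ worker r ω)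
      (arrivalError F D ξ γ thr x₀ worker q ω) ∂μ = 0 := by
  refine h.integral_inner_error γ x₀ worker ?_ ?_
    (h.sqIntegrable_error γ x₀ worker (h.sqIntegrable_model γ x₀ worker r)).1
  · rw [ht]
    exact Set.subset_insert _ _
  · rintro (hl | ⟨s, hs, hl⟩)
    · exact hqr (label_injective worker hl)
    · rw [label_injective worker hl, ht] at hs
      exact lt_irrefl _ hs

/-- A linear combination of gradient errors of the same round. -/
theorem Sampling.integral_norm_sq_sum_error (h : Sampling F D μ ξ L σ thr) {t : ℕ}
    (A : Finset ℕ) (hA : ∀ r ∈ A, tableRound thr worker r = t) (c : ℕ → ℝ) :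
    ∫ ω, ‖∑ r ∈ A, c r • arrivalError F D ξ γ thr x₀ worker r ω‖ ^ 2 ∂μ ≤
      (∑ r ∈ A, c r ^ 2) * σ ^ 2 := by
  set e := arrivalError F D ξ γ thr x₀ worker with he
  have hint : ∀ r s, Integrable (fun ω => c r * (c s * inner ℝ (e r ω) (e s ω))) μ :=
    fun r s => ((integrable_inner_of_memLp (h.memLp_error γ x₀ worker r)
      (h.memLp_error γ x₀ worker s)).const_mul _).const_mul _
  have hexp : ∀ ω, ‖∑ r ∈ A, c r • e r ω‖ ^ 2 =
      ∑ r ∈ A, ∑ s ∈ A, c r * (c s * inner ℝ (e r ω) (e s ω)) := by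
    intro ω
    rw [← real_inner_self_eq_norm_sq, sum_inner]
    refine Finset.sum_congr rfl fun r _ => ?_
    rw [inner_sum]
    refine Finset.sum_congr rfl fun s _ => ?_
    rw [inner_smul_left, inner_smul_right]
    rfl
  simp only [hexp]
  rw [integral_finsetSum _ fun r _ => integrable_finsetSum _ fun s _ => hint r s,
    Finset.sum_mul]
  refine Finset.sum_le_sum fun r hr => ?_
  -- The off-diagonal terms vanish by orthogonality.
  rw [integral_finsetSum _ fun s _ => hint r s, Finset.sum_eq_single r]
  · rw [integral_const_mul, integral_const_mul, ← mul_assoc, ← sq]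
    refine mul_le_mul_of_nonneg_left ?_ (sq_nonneg _)
    simp only [real_inner_self_eq_norm_sq]
    exact (h.sqIntegrable_error γ x₀ worker (h.sqIntegrable_model γ x₀ worker r)).2
  · intro s hs hsr
    rw [integral_const_mul, integral_const_mul,
      h.integral_inner_error_error γ x₀ worker hsr ((hA s hs).trans (hA r hr).symm)]
    simp
  · exact fun hr' => absurd hr hr'

end

/-! ### The decrease of the potential in one round -/

section

variable {d n : ℕ} {Ξ : Fin n → Type*} [∀ i, MeasurableSpace (Ξ i)]
  (F : ∀ i, Vec d → Ξ i → ℝ) (D : ∀ i, Measure (Ξ i))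
  {L : ℝ}

/-- The average of the local gradients at the points `y i`. -/
def meanGrad (y : Fin n → Vec d) : Vec d :=
  (1 / (n : ℝ)) • ∑ i, gradient (localObjective F D i) (y i)

theorem norm_sq_sum_le {ι : Type*} (s : Finset ι) (v : ι → Vec d) :
    ‖∑ i ∈ s, v i‖ ^ 2 ≤ s.card * ∑ i ∈ s, ‖v i‖ ^ 2 := by
  calc ‖∑ i ∈ s, v i‖ ^ 2 ≤ (∑ i ∈ s, ‖v i‖) ^ 2 := by
        gcongr
        exact norm_sum_le _ _
    _ ≤ _ := sq_sum_le_card_mul_sum_sq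

theorem norm_add_sq_le (v w : Vec d) : ‖v + w‖ ^ 2 ≤ 2 * (‖v‖ ^ 2 + ‖w‖ ^ 2) := by
  have := parallelogram_law_with_norm ℝ v w
  nlinarith [mul_self_nonneg ‖v - w‖]

variable {F D}

/-- The descent lemma is applied to the whole round as one step of length `nγ = 1/(10L)`. Writing
`⟨g, H⟩` by polarization produces `-‖g‖²`, `-‖H‖²` and `+‖g - H‖²`; generalized smoothness bounds
the last by exactly the old drift term of the potential. The quadratic remainder and the new drift
are paid for by `-‖H‖²`, up to noise. -/
theorem GeneralizedSmooth.round_decrease (h : GeneralizedSmooth F D L) (hn : 0 < n) (hL : 0 < L)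
    (z : Vec d) (y e : Fin n → Vec d) (P : Fin n → Finset (Fin n)) {γ : ℝ}
    (hγ : γ = 1 / (10 * n * L)) :
    objective F D (z - γ • ∑ l, (meanGrad F D y + e l)) +
      L / (20 * n) * ∑ i, ‖(z - γ • ∑ l, (meanGrad F D y + e l)) -
        (z - γ • ∑ l ∈ P i, (meanGrad F D y + e l))‖ ^ 2 ≤
    objective F D z + L / (20 * n) * ∑ i, ‖z - y i‖ ^ 2 -
      1 / (20 * L) * ‖gradient (objective F D) z‖ ^ 2 +
      22 / (2000 * L) * ((1 / (n : ℝ)) * ∑ l, ‖e l‖ ^ 2) -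
      γ * ∑ l, inner ℝ (gradient (objective F D) z) (e l) := by
  have hn' : (0 : ℝ) < n := by exact_mod_cast hn
  have hγ0 : 0 < γ := by rw [hγ]; positivity
  set H := meanGrad F D y with hH
  set N := (1 / (n : ℝ)) * ∑ l, ‖e l‖ ^ 2 with hN
  set g := gradient (objective F D) z with hg
  have hsm : ‖g - H‖ ^ 2 ≤ L ^ 2 / n * ∑ i, ‖z - y i‖ ^ 2 := h.smooth z y
  have hpart : ∀ s : Finset (Fin n), ‖∑ l ∈ s, (H + e l)‖ ^ 2 ≤ n ^ 2 * (2 * (‖H‖ ^ 2 + N)) := by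
    intro s
    have h1 : ∑ l, ‖H + e l‖ ^ 2 ≤ n * (2 * (‖H‖ ^ 2 + N)) := by
      calc ∑ l, ‖H + e l‖ ^ 2 ≤ ∑ l, 2 * (‖H‖ ^ 2 + ‖e l‖ ^ 2) :=
            Finset.sum_le_sum fun l _ => norm_add_sq_le _ _
        _ = n * (2 * (‖H‖ ^ 2 + N)) := by
            rw [← Finset.mul_sum, Finset.sum_add_distrib, Finset.sum_const, Finset.card_univ,
              Fintype.card_fin, nsmul_eq_mul, hN]
            field_simp
    calc ‖∑ l ∈ s, (H + e l)‖ ^ 2 ≤ s.card * ∑ l ∈ s, ‖H + e l‖ ^ 2 := norm_sq_sum_le _ _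
      _ ≤ n * ∑ l, ‖H + e l‖ ^ 2 := by
          gcongr
          · exact_mod_cast (Finset.card_le_univ s).trans_eq (Fintype.card_fin n)
          · exact Finset.subset_univ s
      _ ≤ n * (n * (2 * (‖H‖ ^ 2 + N))) := by gcongr
      _ = _ := by ring
  have hdrift : ∑ i, ‖(z - γ • ∑ l, (H + e l)) - (z - γ • ∑ l ∈ P i, (H + e l))‖ ^ 2 ≤
      n * (γ ^ 2 * (n ^ 2 * (2 * (‖H‖ ^ 2 + N)))) := by
    calc _ ≤ ∑ _i : Fin n, γ ^ 2 * (n ^ 2 * (2 * (‖H‖ ^ 2 + N))) := by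
          refine Finset.sum_le_sum fun i _ => ?_
          -- The model of worker `i` differs from the final one by the updates made after its own,
          -- so the bound for arbitrary partial sums applies.
          have h1 : (z - γ • ∑ l, (H + e l)) - (z - γ • ∑ l ∈ P i, (H + e l)) =
              -(γ • ∑ l ∈ (P i)ᶜ, (H + e l)) := by
            rw [← Finset.sum_add_sum_compl (P i), smul_add]
            abel
          rw [h1, norm_neg, norm_smul, mul_pow, Real.norm_of_nonneg hγ0.le]
          gcongr
          exact hpart _
      _ = _ := by simp
  have hdesc := le_quadratic_of_gradient_lipschitz h.differentiable_objective
    (h.lipschitz_objective hn hL) z (-(γ • ∑ l, (H + e l)))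
  rw [← sub_eq_add_neg, norm_neg, norm_smul, mul_pow, Real.norm_of_nonneg hγ0.le, inner_neg_right,
    inner_smul_right, Finset.sum_add_distrib, inner_add_right, Finset.sum_const,
    Finset.card_univ, Fintype.card_fin, ← Nat.cast_smul_eq_nsmul ℝ, inner_smul_right,
    inner_sum] at hdesc
  have hfull := hpart Finset.univ
  rw [Finset.sum_add_distrib, Finset.sum_const, Finset.card_univ, Fintype.card_fin,
    ← Nat.cast_smul_eq_nsmul ℝ] at hfull
  have hinner : inner ℝ g H = (‖g‖ ^ 2 + ‖H‖ ^ 2 - ‖g - H‖ ^ 2) / 2 := by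
    rw [norm_sub_sq_real]; ring
  rw [← hg, hinner] at hdesc
  have hnγ : n * γ = 1 / (10 * L) := by rw [hγ]; field_simp
  have e1 : L / 2 * (γ ^ 2 * (n ^ 2 * (2 * (‖H‖ ^ 2 + N)))) = 1 / (100 * L) * (‖H‖ ^ 2 + N) := by
    have : L / 2 * (γ ^ 2 * (n ^ 2 * (2 * (‖H‖ ^ 2 + N)))) = L * (n * γ) ^ 2 * (‖H‖ ^ 2 + N) := by
      ring
    rw [this, hnγ]; field_simp; ring
  have e2 : L / (20 * n) * (n * (γ ^ 2 * (n ^ 2 * (2 * (‖H‖ ^ 2 + N))))) =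
      1 / (1000 * L) * (‖H‖ ^ 2 + N) := by
    have : L / (20 * n) * (n * (γ ^ 2 * (n ^ 2 * (2 * (‖H‖ ^ 2 + N))))) =
        L / 10 * (n * γ) ^ 2 * (‖H‖ ^ 2 + N) := by field_simp; ring
    rw [this, hnγ]; field_simp; ring
  have e3 : γ * (n * ((‖g‖ ^ 2 + ‖H‖ ^ 2 - ‖g - H‖ ^ 2) / 2) +
      ∑ l, inner ℝ g (e l)) = 1 / (20 * L) * (‖g‖ ^ 2 + ‖H‖ ^ 2) - 1 / (20 * L) * ‖g - H‖ ^ 2 +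
        γ * ∑ l, inner ℝ g (e l) := by
    have : γ * (n * ((‖g‖ ^ 2 + ‖H‖ ^ 2 - ‖g - H‖ ^ 2) / 2) + ∑ l, inner ℝ g (e l)) =
      (n * γ) / 2 * (‖g‖ ^ 2 + ‖H‖ ^ 2 - ‖g - H‖ ^ 2) + γ * ∑ l, inner ℝ g (e l) := by ring
    rw [this, hnγ]; field_simp; ring
  have e4 : 1 / (20 * L) * (L ^ 2 / n * ∑ i, ‖z - y i‖ ^ 2) =
      L / (20 * n) * ∑ i, ‖z - y i‖ ^ 2 := by field_simp
  have i1 := mul_le_mul_of_nonneg_left hsm (by positivity : 0 ≤ 1 / (20 * L))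
  rw [e4] at i1
  have i2 := mul_le_mul_of_nonneg_left hdrift (by positivity : 0 ≤ L / (20 * n))
  rw [e2] at i2
  have i3 := mul_le_mul_of_nonneg_left hfull (by positivity : 0 ≤ L / 2 * γ ^ 2)
  rw [mul_assoc (L / 2), mul_assoc (L / 2), e1] at i3
  rw [e3] at hdesc
  simp only [Finset.sum_add_distrib, Finset.sum_const, Finset.card_univ, Fintype.card_fin,
    ← Nat.cast_smul_eq_nsmul ℝ] at i2 ⊢
  have hH0 : 0 ≤ 1 / (20 * L) * ‖H‖ ^ 2 := by positivity
  -- Remainder and new drift together use only 22 percent of the available `‖H‖² / (20 L)`; the rest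
  -- is dropped.
  have e5 : 1 / (100 * L) * (‖H‖ ^ 2 + N) + 1 / (1000 * L) * (‖H‖ ^ 2 + N) =
      22 / 100 * (1 / (20 * L) * ‖H‖ ^ 2) + 22 / (2000 * L) * N := by field_simp; ring
  linarith

variable {Ω : Type*} [mΩ : MeasurableSpace Ω] {μ : Measure Ω} [IsProbabilityMeasure μ]

variable (F D L μ) in
/-- The potential of a round that starts at the model `z`, while the gradients of worker `i` in its
table are taken at `y i`. -/
def potential (z : Ω → Vec d) (y : Fin n → Ω → Vec d) : ℝ :=
  ∫ ω, objective F D (z ω) + L / (20 * n) * ∑ i, ‖z ω - y i ω‖ ^ 2 ∂μ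

theorem GeneralizedSmooth.memLp_meanGrad (h : GeneralizedSmooth F D L) (hn : 0 < n) (hL : 0 < L)
    {y : Fin n → Ω → Vec d} (hy : ∀ i, SqIntegrable mΩ μ (y i)) :
    SqIntegrable mΩ μ fun ω => meanGrad F D fun i => y i ω :=
  SqIntegrable.const_smul (SqIntegrable.sum fun i _ =>
    (hy i).comp_lipschitz (h.lipschitz_local hn hL i)) _

theorem GeneralizedSmooth.potential_decrease (h : GeneralizedSmooth F D L) (hn : 0 < n)
    (hL : 0 < L) {c ε : ℝ} (hc : ∀ x, c ≤ objective F D x) {z : Ω → Vec d}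
    {y e : Fin n → Ω → Vec d}
    (P : Fin n → Finset (Fin n)) {γ : ℝ} (hγ : γ = 1 / (10 * n * L))
    (hz : SqIntegrable mΩ μ z) (hy : ∀ i, SqIntegrable mΩ μ (y i))
    (he : ∀ i, MemLp (e i) 2 μ) (he2 : ∀ i, ∫ ω, ‖e i ω‖ ^ 2 ∂μ ≤ ε)
    (horth : ∀ i, ∫ ω, inner ℝ (gradient (objective F D) (z ω)) (e i ω) ∂μ = 0) :
    potential F D L μ (fun ω => z ω - γ • ∑ l, ((meanGrad F D fun i => y i ω) + e l ω))
      (fun i ω => z ω - γ • ∑ l ∈ P i, ((meanGrad F D fun i => y i ω) + e l ω)) ≤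
    potential F D L μ z y - 1 / (20 * L) *
      (∫ ω, ‖gradient (objective F D) (z ω)‖ ^ 2 ∂μ - 22 / 100 * ε) := by
  have hn' : (0 : ℝ) < n := by exact_mod_cast hn
  have hH := (h.memLp_meanGrad hn hL hy).memLp
  have hpart : ∀ s : Finset (Fin n), MemLp
      (fun ω => z ω - γ • ∑ l ∈ s, ((meanGrad F D fun i => y i ω) + e l ω)) 2 μ := fun s =>
    hz.memLp.sub ((memLp_finsetSum s fun l _ => hH.add (he l)).const_smul γ)
  have hf : ∀ {X : Ω → Vec d}, MemLp X 2 μ → Integrable (fun ω => objective F D (X ω)) μ :=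
    fun hX => integrable_comp_of_smooth h.differentiable_objective
      (h.lipschitz_objective hn hL) hc hX
  have hg := hz.comp_lipschitz (h.lipschitz_objective hn hL)
  have hpot : ∀ {X : Ω → Vec d} {Y : Fin n → Ω → Vec d}, MemLp X 2 μ → (∀ i, MemLp (Y i) 2 μ) →
      Integrable (fun ω => objective F D (X ω) + L / (20 * n) * ∑ i, ‖X ω - Y i ω‖ ^ 2) μ :=
    fun hX hY => (hf hX).add ((integrable_finsetSum _ fun i _ =>
      integrable_norm_sq_of_memLp (hX.sub (hY i))).const_mul _)
  have i1 := hpot hz.memLp fun i => (hy i).memLp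
  have i2 := (integrable_norm_sq_of_memLp hg.memLp).const_mul (1 / (20 * L))
  have i3 : Integrable (fun ω => 22 / (2000 * L) * ((1 / (n : ℝ)) * ∑ l, ‖e l ω‖ ^ 2)) μ :=
    ((integrable_finsetSum _ fun l _ => integrable_norm_sq_of_memLp (he l)).const_mul _).const_mul _
  have i4 : Integrable
      (fun ω => γ * ∑ l, inner ℝ (gradient (objective F D) (z ω)) (e l ω)) μ :=
    (integrable_finsetSum _ fun l _ => integrable_inner_of_memLp hg.memLp (he l)).const_mul _
  have hle := integral_mono (hpot (hpart Finset.univ) fun i => hpart (P i))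
    (((i1.sub i2).add i3).sub i4)
    (fun ω => h.round_decrease hn hL (z ω) (fun i => y i ω) (fun i => e i ω) P hγ)
  refine hle.trans ?_
  have e1 := integral_sub' ((i1.sub i2).add i3) i4
  have e2 := integral_add' (i1.sub i2) i3
  have e3 := integral_sub' i1 i2
  rw [e1, e2, e3, integral_const_mul, integral_const_mul, integral_const_mul, integral_const_mul,
    integral_finsetSum _ fun l _ => integrable_inner_of_memLp hg.memLp (he l),
    integral_finsetSum _ fun l _ => integrable_norm_sq_of_memLp (he l)]
  simp only [horth, Finset.sum_const_zero, mul_zero, sub_zero]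
  have hN : (1 / (n : ℝ)) * ∑ l, ∫ ω, ‖e l ω‖ ^ 2 ∂μ ≤ ε := by
    calc (1 / (n : ℝ)) * ∑ l, ∫ ω, ‖e l ω‖ ^ 2 ∂μ ≤ (1 / (n : ℝ)) * ∑ _l : Fin n, ε := by
          gcongr with l
          exact he2 l
      _ = ε := by simp; field_simp
  have hN' := mul_le_mul_of_nonneg_left hN (by positivity : 0 ≤ 22 / (2000 * L))
  have e5 : 1 / (20 * L) * (∫ ω, ‖gradient (objective F D) (z ω)‖ ^ 2 ∂μ - 22 / 100 * ε) =
      1 / (20 * L) * ∫ ω, ‖gradient (objective F D) (z ω)‖ ^ 2 ∂μ - 22 / (2000 * L) * ε := by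
    field_simp; ring
  rw [e5, potential]
  linarith

end

/-! ### The structure of a round -/

section

variable {d n : ℕ} {Ξ : Fin n → Type*} [∀ i, MeasurableSpace (Ξ i)]
  {F : ∀ i, Vec d → Ξ i → ℝ} {D : ∀ i, Measure (Ξ i)} [∀ i, IsProbabilityMeasure (D i)]
  {Ω : Type*} [mΩ : MeasurableSpace Ω] {μ : Measure Ω} [IsProbabilityMeasure μ]
  {ξ : ∀ i, ℕ → Ω → Ξ i} {L σ γ thr ε : ℝ} {x₀ : Vec d} {worker : ℕ → Fin n}

variable (μ ξ thr ε worker) in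
/-- The properties of the error of an update in round `t`. -/
structure IsRoundError (t : ℕ) (e : Ω → Vec d) : Prop where
  memLp : MemLp e 2 μ
  norm_le : ∫ ω, ‖e ω‖ ^ 2 ∂μ ≤ ε
  orthogonal : ∀ V : Ω → Vec d, SqIntegrable (sampleSigma ξ (pastLabels thr worker t)) μ V →
    ∫ ω, inner ℝ (V ω) (e ω) ∂μ = 0

variable (F D ξ γ thr x₀ worker) in
/-- The error of the update that follows arrival `q`. -/
def updateError (q : ℕ) (ω : Ω) : Vec d :=
  (1 / (n : ℝ)) • ∑ i, ((table thr worker (schedule thr worker q).round i (q + 1)).card : ℝ)⁻¹ •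
    ∑ r ∈ table thr worker (schedule thr worker q).round i (q + 1),
      arrivalError F D ξ γ thr x₀ worker r ω

omit [∀ i, MeasurableSpace (Ξ i)] [∀ i, IsProbabilityMeasure (D i)] mΩ [IsProbabilityMeasure μ] in
theorem thr_le_harmonicMean_table (hn : 0 < n) (hthr : 0 < thr) {q : ℕ}
    (hd : DescendsAt thr worker q) :
    thr ≤ harmonicMean fun i =>
      (table thr worker (schedule thr worker q).round i (q + 1)).card := by
  have h1 := (schedule_valid thr worker hn hthr q).thr_le_of_descends hd
  have h2 : (fun i => (table thr worker (schedule thr worker q).round i (q + 1)).card) =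
      Function.update (schedule thr worker q).b (worker q)
        ((schedule thr worker q).b (worker q) + 1) := by
    ext i
    have hc := sum_table_succ thr worker (fun _ => 1) (tableRound_of_notMem thr worker hd.1) i
    simp only [Finset.sum_const, smul_eq_mul, mul_one] at hc
    rw [hc]
    simp only [← (schedule_b thr worker hn hthr q).1]
  rwa [h2]

-- The sum equals `1/n` divided by the harmonic mean of `b`, so the stopping rule is precisely what
-- keeps the variance of an update below `ε`.
omit [∀ i, MeasurableSpace (Ξ i)] [∀ i, IsProbabilityMeasure (D i)] mΩ [IsProbabilityMeasure μ] in
theorem sum_inv_mul_sq_le (hn : 0 < n) (hthr : 0 < thr) (hε : 0 < ε)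
    (hσ : σ ^ 2 / (n * ε) ≤ thr) {b : Fin n → ℕ} (hb : thr ≤ harmonicMean b) :
    (∑ i, (b i : ℝ) * ((1 / (n : ℝ)) * (b i : ℝ)⁻¹) ^ 2) * σ ^ 2 ≤ ε := by
  have hn' : (0 : ℝ) < n := by exact_mod_cast hn
  have hpos := pos_of_harmonicMean_pos (hthr.trans_le hb)
  rw [harmonicMean, if_pos hpos] at hb
  set S := (1 / (n : ℝ)) * ∑ i, (b i : ℝ)⁻¹ with hS
  have hS0 : 0 < S := inv_pos.1 (hthr.trans_le hb)
  have h1 : ∑ i, (b i : ℝ) * ((1 / (n : ℝ)) * (b i : ℝ)⁻¹) ^ 2 = (1 / (n : ℝ)) * S := by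
    rw [hS, Finset.mul_sum, Finset.mul_sum]
    refine Finset.sum_congr rfl fun i _ => ?_
    have : (b i : ℝ) ≠ 0 := by exact_mod_cast (hpos i).ne'
    field_simp
  rw [h1]
  have h2 := hσ.trans hb
  rw [div_le_iff₀ (by positivity)] at h2
  have h3 := mul_le_mul_of_nonneg_right h2 (by positivity : 0 ≤ (1 / (n : ℝ)) * S)
  calc 1 / (n : ℝ) * S * σ ^ 2 = σ ^ 2 * (1 / (n : ℝ) * S) := by ring
    _ ≤ S⁻¹ * (n * ε) * (1 / (n : ℝ) * S) := h3
    _ = ε := by field_simp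

theorem Sampling.isRoundError (h : Sampling F D μ ξ L σ thr) (hε : 0 < ε)
    (hσ : σ ^ 2 / (n * ε) ≤ thr) {q : ℕ} (hd : DescendsAt thr worker q) :
    IsRoundError μ ξ thr ε worker (schedule thr worker q).round
      (updateError F D ξ γ thr x₀ worker q) := by
  set t := (schedule thr worker q).round with ht
  set A := (Finset.range (q + 1)).filter fun r => tableRound thr worker r = t with hA
  set c : ℕ → ℝ := fun r => (1 / (n : ℝ)) * ((table thr worker t (worker r) (q + 1)).card : ℝ)⁻¹
    with hc
  have hAt : ∀ r ∈ A, tableRound thr worker r = t := fun r hr => (Finset.mem_filter.1 hr).2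
  have hfib : ∀ i, A.filter (fun r => worker r = i) = table thr worker t i (q + 1) := by
    intro i
    ext r
    simp only [hA, Finset.mem_filter, Finset.mem_range, mem_table]
    tauto
  -- The double sum over workers and their arrivals becomes one weighted sum over the arrivals of
  -- the round, with weight `1 / (n b_i)`.
  have he : updateError F D ξ γ thr x₀ worker q =
      fun ω => ∑ r ∈ A, c r • arrivalError F D ξ γ thr x₀ worker r ω := by
    ext1 ω
    rw [updateError, Finset.smul_sum, ← Finset.sum_fiberwise A worker]
    refine Finset.sum_congr rfl fun i _ => ?_
    rw [hfib, smul_smul, Finset.smul_sum]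
    refine Finset.sum_congr rfl fun r hr => ?_
    rw [mem_table] at hr
    simp only [hc, hr.2.1, ht]
  rw [he]
  refine ⟨memLp_finsetSum _ fun r _ => (h.memLp_error γ x₀ worker r).const_smul (c r), ?_,
    fun V hV => ?_⟩
  · refine (h.integral_norm_sq_sum_error γ x₀ worker A hAt c).trans ?_
    have h1 : ∑ r ∈ A, c r ^ 2 = ∑ i, ((table thr worker t i (q + 1)).card : ℝ) *
        ((1 / (n : ℝ)) * ((table thr worker t i (q + 1)).card : ℝ)⁻¹) ^ 2 := by
      rw [← Finset.sum_fiberwise A worker]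
      refine Finset.sum_congr rfl fun i _ => ?_
      rw [hfib, ← nsmul_eq_mul, ← Finset.sum_const]
      refine Finset.sum_congr rfl fun r hr => ?_
      rw [mem_table] at hr
      simp only [hc, hr.2.1]
    rw [h1]
    exact sum_inv_mul_sq_le h.pos h.thr_pos hε hσ
      (thr_le_harmonicMean_table h.pos h.thr_pos hd)
  · simp only [inner_sum, inner_smul_right]
    rw [integral_finsetSum _ fun r _ => (integrable_inner_of_memLp hV.memLp
      (h.memLp_error γ x₀ worker r)).const_mul _]
    refine Finset.sum_eq_zero fun r hr => ?_
    rw [integral_const_mul, h.integral_inner_error_past γ x₀ worker (by rwa [hAt r hr]), mul_zero]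

variable (F D μ ξ γ thr ε x₀ worker) in
/-- The state after `q` arrivals in terms of the model `z` at the start of the current round, the
points `y i` at which the gradients in its table are taken, the errors `e i` of its updates, and
the sets `P i` of the workers that were updated in it before worker `i` or are worker `i`. -/
structure RoundState (q : ℕ) (z : Ω → Vec d) (y e : Fin n → Ω → Vec d)
    (P : Fin n → Finset (Fin n)) : Prop where
  start : ∃ s ≤ q, z = iterate F ξ γ thr x₀ worker s
  sq_z : SqIntegrable
    (sampleSigma ξ (pastLabels thr worker (schedule thr worker q).round)) μ z
  sq_y : ∀ i, SqIntegrable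
    (sampleSigma ξ (pastLabels thr worker (schedule thr worker q).round)) μ (y i)
  error : ∀ i ∈ (schedule thr worker q).updated,
    IsRoundError μ ξ thr ε worker (schedule thr worker q).round (e i)
  iterate_eq : iterate F ξ γ thr x₀ worker q = fun ω =>
    z ω - γ • ∑ l ∈ (schedule thr worker q).updated, ((meanGrad F D fun i => y i ω) + e l ω)
  not_updated : ∀ i ∉ (schedule thr worker q).updated,
    workerModel F ξ γ thr x₀ worker q i = y i
  updated : ∀ i ∈ (schedule thr worker q).updated, P i ⊆ (schedule thr worker q).updated ∧
    workerModel F ξ γ thr x₀ worker q i = fun ω =>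
      z ω - γ • ∑ l ∈ P i, ((meanGrad F D fun i => y i ω) + e l ω)
  current : ∀ r < q, tableRound thr worker r = (schedule thr worker q).round →
    workerModel F ξ γ thr x₀ worker r (worker r) = y (worker r)
  next : ∀ r < q, tableRound thr worker r = (schedule thr worker q).round + 1 →
    worker r ∈ (schedule thr worker q).updated ∧
    workerModel F ξ γ thr x₀ worker r (worker r) = workerModel F ξ γ thr x₀ worker q (worker r)

omit [∀ i, IsProbabilityMeasure (D i)] [IsProbabilityMeasure μ] in
theorem RoundState.succ_of_not_descends (hn : 0 < n) (hthr : 0 < thr) {q : ℕ} {z : Ω → Vec d}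
    {y e : Fin n → Ω → Vec d}
    {P : Fin n → Finset (Fin n)} (hs : RoundState F D μ ξ γ thr ε x₀ worker q z y e P)
    (hd : ¬ DescendsAt thr worker q) :
    RoundState F D μ ξ γ thr ε x₀ worker (q + 1) z y e P := by
  obtain ⟨hx, hm⟩ :=
    iterate_succ_of_not_descends (F := F) (ξ := ξ) γ x₀ worker hn hthr hd
  obtain ⟨hround, hupd⟩ : (schedule thr worker (q + 1)).round = (schedule thr worker q).round ∧
      (schedule thr worker (q + 1)).updated = (schedule thr worker q).updated := by
    rw [schedule]
    by_cases hj : worker q ∈ (schedule thr worker q).updated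
    · rw [Schedule.step_of_mem hj]
      exact ⟨rfl, rfl⟩
    · rw [Schedule.step_of_not_descends hj hd]
      exact ⟨rfl, rfl⟩
  obtain ⟨s, hsq, hz⟩ := hs.start
  refine ⟨⟨s, hsq.trans (Nat.le_succ q), hz⟩, by rw [hround]; exact hs.sq_z,
    by rw [hround]; exact hs.sq_y, by rw [hround, hupd]; exact hs.error,
    by rw [hx, hupd]; exact hs.iterate_eq, by rw [hm, hupd]; exact hs.not_updated,
    by rw [hm, hupd]; exact hs.updated, ?_, ?_⟩
  · rw [hround]
    intro r hr ht
    rcases Nat.lt_succ_iff_lt_or_eq.1 hr with hr | rfl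
    · exact hs.current r hr ht
    · refine hs.not_updated _ fun hj => ?_
      rw [tableRound_of_mem thr worker hj] at ht
      omega
  · rw [hround, hupd, hm]
    intro r hr ht
    rcases Nat.lt_succ_iff_lt_or_eq.1 hr with hr | rfl
    · exact hs.next r hr ht
    · refine ⟨?_, rfl⟩
      by_contra hj
      rw [tableRound_of_notMem thr worker hj] at ht
      omega

-- All gradients of worker `i` in the table are taken at `y i`, so their average is `∇f_i(y i)` plus
-- averaged noise; the batch is nonempty by the stopping rule.
omit [∀ i, IsProbabilityMeasure (D i)] [IsProbabilityMeasure μ] in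
theorem RoundState.iterate_succ (h : Sampling F D μ ξ L σ thr) {q : ℕ} {z : Ω → Vec d}
    {y e : Fin n → Ω → Vec d}
    {P : Fin n → Finset (Fin n)} (hs : RoundState F D μ ξ γ thr ε x₀ worker q z y e P)
    (hd : DescendsAt thr worker q) :
    iterate F ξ γ thr x₀ worker (q + 1) = fun ω => iterate F ξ γ thr x₀ worker q ω -
      γ • ((meanGrad F D fun i => y i ω) + updateError F D ξ γ thr x₀ worker q ω) := by
  rw [(iterate_succ_of_descends γ x₀ worker h.pos h.thr_pos hd).1]
  ext1 ω
  rw [meanGrad, updateError, ← smul_add, ← Finset.sum_add_distrib]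
  congr 3
  refine Finset.sum_congr rfl fun i _ => ?_
  set B := table thr worker (schedule thr worker q).round i (q + 1) with hB
  have hpos : (0 : ℝ) < B.card := by
    have := pos_of_harmonicMean_pos (h.thr_pos.trans_le
      (thr_le_harmonicMean_table h.pos h.thr_pos hd)) i
    exact_mod_cast this
  have hsum : ∑ r ∈ B, arrival F ξ γ thr x₀ worker r ω =
      (B.card : ℝ) • gradient (localObjective F D i) (y i ω) +
        ∑ r ∈ B, arrivalError F D ξ γ thr x₀ worker r ω := by
    rw [Nat.cast_smul_eq_nsmul, ← Finset.sum_const, ← Finset.sum_add_distrib]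
    refine Finset.sum_congr rfl fun r hr => ?_
    rw [hB, mem_table] at hr
    obtain ⟨hr, hi, ht⟩ := hr
    have hy : workerModel F ξ γ thr x₀ worker r (worker r) = y (worker r) := by
      rcases Nat.lt_succ_iff_lt_or_eq.1 hr with hr | rfl
      · exact hs.current r hr ht
      · exact hs.not_updated _ hd.1
    rw [arrival_eq F D, hy, hi]
  rw [hsum, smul_add, smul_smul, inv_mul_cancel₀ hpos.ne', one_smul]

/-- The effect of an update on the model of each worker that has been updated in the round. -/
theorem RoundState.descend (h : Sampling F D μ ξ L σ thr) (hε : 0 < ε)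
    (hσ : σ ^ 2 / (n * ε) ≤ thr) {q : ℕ} {z : Ω → Vec d} {y e : Fin n → Ω → Vec d}
    {P : Fin n → Finset (Fin n)} (hs : RoundState F D μ ξ γ thr ε x₀ worker q z y e P)
    (hd : DescendsAt thr worker q) :
    ∃ (e' : Fin n → Ω → Vec d) (P' : Fin n → Finset (Fin n)),
      (∀ i ∈ insert (worker q) (schedule thr worker q).updated,
        IsRoundError μ ξ thr ε worker (schedule thr worker q).round (e' i)) ∧
      (iterate F ξ γ thr x₀ worker (q + 1) = fun ω =>
        z ω - γ • ∑ l ∈ insert (worker q) (schedule thr worker q).updated,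
          ((meanGrad F D fun i => y i ω) + e' l ω)) ∧
      ∀ i ∈ insert (worker q) (schedule thr worker q).updated,
        P' i ⊆ insert (worker q) (schedule thr worker q).updated ∧
        workerModel F ξ γ thr x₀ worker (q + 1) i = fun ω =>
          z ω - γ • ∑ l ∈ P' i, ((meanGrad F D fun i => y i ω) + e' l ω) := by
  set U := (schedule thr worker q).updated with hU
  set j := worker q with hj
  have hjU : j ∉ U := hd.1
  set e' := Function.update e j (updateError F D ξ γ thr x₀ worker q) with he'
  have hsub : ∀ {s : Finset (Fin n)}, s ⊆ U → ∀ ω,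
      ∑ l ∈ s, ((meanGrad F D fun i => y i ω) + e' l ω) =
        ∑ l ∈ s, ((meanGrad F D fun i => y i ω) + e l ω) := by
    intro s hsU ω
    refine Finset.sum_congr rfl fun l hl => ?_
    have : l ≠ j := by rintro rfl; exact hjU (hsU hl)
    rw [he', Function.update_of_ne this]
  have hx : iterate F ξ γ thr x₀ worker (q + 1) = fun ω =>
      z ω - γ • ∑ l ∈ insert j U, ((meanGrad F D fun i => y i ω) + e' l ω) := by
    rw [hs.iterate_succ h hd, hs.iterate_eq]
    ext1 ω
    rw [Finset.sum_insert hjU, hsub subset_rfl, he', Function.update_self]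
    module
  refine ⟨e', Function.update P j (insert j U), fun i hi => ?_, hx, fun i hi => ?_⟩
  · by_cases hij : i = j
    · rw [hij, he', Function.update_self]
      exact h.isRoundError hε hσ hd
    · rw [he', Function.update_of_ne hij]
      exact hs.error i ((Finset.mem_insert.1 hi).resolve_left hij)
  · have hm := (iterate_succ_of_descends (F := F) (ξ := ξ) γ x₀ worker h.pos h.thr_pos hd).2
    by_cases hij : i = j
    · rw [hij, hm, Function.update_self, Function.update_self]
      exact ⟨subset_rfl, hx⟩
    · have hiU := (Finset.mem_insert.1 hi).resolve_left hij
      obtain ⟨hP, hmi⟩ := hs.updated i hiU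
      rw [hm, Function.update_of_ne hij, Function.update_of_ne hij]
      refine ⟨hP.trans (Finset.subset_insert _ _), ?_⟩
      simp only [hsub hP]
      exact hmi

/-- The potential refers to the start of a round, so it changes only at the arrival that ends one.
-/
theorem RoundState.potential_succ (h : Sampling F D μ ξ L σ thr) (hε : 0 < ε)
    (hσ : σ ^ 2 / (n * ε) ≤ thr) (hγ : γ = 1 / (10 * n * L)) {c : ℝ}
    (hc : ∀ x, c ≤ objective F D x) {q : ℕ} {z : Ω → Vec d} {y e : Fin n → Ω → Vec d}
    {P : Fin n → Finset (Fin n)} (hs : RoundState F D μ ξ γ thr ε x₀ worker q z y e P)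
    (hbig : ∀ s ≤ q,
      ε < ∫ ω, ‖gradient (objective F D) (iterate F ξ γ thr x₀ worker s ω)‖ ^ 2 ∂μ) {B : ℝ}
    (hpot : potential F D L μ z y ≤
      B - (schedule thr worker q).round * (39 / 1000 * ε / L)) :
    ∃ z' y' e' P', RoundState F D μ ξ γ thr ε x₀ worker (q + 1) z' y' e' P' ∧
      potential F D L μ z' y' ≤
        B - (schedule thr worker (q + 1)).round * (39 / 1000 * ε / L) := by
  by_cases hd : DescendsAt thr worker q
  swap
  · refine ⟨z, y, e, P, hs.succ_of_not_descends h.pos h.thr_pos hd, ?_⟩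
    have hround : (schedule thr worker (q + 1)).round = (schedule thr worker q).round := by
      rw [schedule]
      by_cases hj : worker q ∈ (schedule thr worker q).updated
      · rw [Schedule.step_of_mem hj]
      · rw [Schedule.step_of_not_descends hj hd]
    rwa [hround]
  obtain ⟨e', P', herr, hx, hP⟩ := hs.descend h hε hσ hd
  have hm := (iterate_succ_of_descends (F := F) (ξ := ξ) γ x₀ worker h.pos h.thr_pos hd).2
  have ht := tableRound_of_notMem thr worker hd.1
  obtain ⟨s, hsq, hz⟩ := hs.start
  by_cases hl : insert (worker q) (schedule thr worker q).updated = Finset.univ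
  · have hsch : schedule thr worker (q + 1) = _ := Schedule.step_of_last hd hl
    have hround : (schedule thr worker (q + 1)).round = (schedule thr worker q).round + 1 := by
      rw [hsch]
    have hupd : (schedule thr worker (q + 1)).updated = ∅ := by rw [hsch]
    rw [hl] at herr hx hP
    have hsq1 := h.sqIntegrable_iterate γ x₀ worker (q + 1)
    rw [activeRound, if_pos hupd, add_zero] at hsq1
    -- The new round starts at the current iterate and uses gradients at the models that the workers
    -- now hold. Nobody has been updated in it, so the errors and sets are irrelevant.
    refine ⟨iterate F ξ γ thr x₀ worker (q + 1), workerModel F ξ γ thr x₀ worker (q + 1), e', P',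
      ⟨⟨q + 1, le_rfl, rfl⟩, hsq1.1, hsq1.2.1, ?_, ?_, fun _ _ => rfl, ?_, ?_, ?_⟩, ?_⟩
    · rw [hupd]; simp
    · rw [hupd]; simp
    · rw [hupd]; simp
    · rw [hround]
      intro r hr htr
      rcases Nat.lt_succ_iff_lt_or_eq.1 hr with hr | rfl
      · obtain ⟨h1, h2⟩ := hs.next r hr htr
        -- Workers with buffered gradients were updated earlier in the round, so their model is
        -- untouched by this last update.
        have : worker r ≠ worker q := fun heq => hd.1 (heq ▸ h1)
        rw [h2, hm, Function.update_of_ne this]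
      · omega
    · intro r hr htr
      have := tableRound_le thr worker hr
      rw [if_pos hupd] at this
      omega
    · have hy' : workerModel F ξ γ thr x₀ worker (q + 1) = fun i ω =>
          z ω - γ • ∑ l ∈ P' i, ((meanGrad F D fun i => y i ω) + e' l ω) :=
        funext fun i => (hP i (Finset.mem_univ i)).2
      have hle := h.sampleSigma_le (pastLabels thr worker (schedule thr worker q).round)
      have hdec := h.smooth.potential_decrease h.pos h.L_pos (e := e') hc P' hγ
        (hs.sq_z.mono hle) (fun i => (hs.sq_y i).mono hle)
        (fun i => (herr i (Finset.mem_univ i)).memLp)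
        (fun i => (herr i (Finset.mem_univ i)).norm_le)
        (fun i => (herr i (Finset.mem_univ i)).orthogonal _
          (hs.sq_z.comp_lipschitz (h.smooth.lipschitz_objective h.pos h.L_pos)))
      rw [hx, hy', hround]
      refine hdec.trans ?_
      have hb := hbig s hsq
      rw [← hz] at hb
      have hL := h.L_pos
      -- The constant is `(1 - 22/100) / 20`. The gradient at `z` is large because `z` is itself an
      -- iterate of the run.
      have h1 : 39 / 1000 * ε / L ≤ 1 / (20 * L) *
          (∫ ω, ‖gradient (objective F D) (z ω)‖ ^ 2 ∂μ - 22 / 100 * ε) := by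
        calc 39 / 1000 * ε / L = 1 / (20 * L) * (ε - 22 / 100 * ε) := by field_simp; ring
          _ ≤ _ := by gcongr
      push_cast
      linarith
  · have hsch : schedule thr worker (q + 1) = _ := Schedule.step_of_descends hd hl
    have hround : (schedule thr worker (q + 1)).round = (schedule thr worker q).round := by
      rw [hsch]
    have hupd : (schedule thr worker (q + 1)).updated =
        insert (worker q) (schedule thr worker q).updated := by rw [hsch]
    refine ⟨z, y, e', P', ⟨⟨s, hsq.trans (Nat.le_succ q), hz⟩, by rw [hround]; exact hs.sq_z,
      by rw [hround]; exact hs.sq_y, by rw [hround, hupd]; exact herr, by rw [hupd]; exact hx,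
      ?_, by rw [hupd]; exact hP, ?_, ?_⟩, by rwa [hround]⟩
    · rw [hupd]
      intro i hi
      rw [Finset.mem_insert, not_or] at hi
      rw [hm, Function.update_of_ne hi.1]
      exact hs.not_updated i hi.2
    · rw [hround]
      intro r hr htr
      rcases Nat.lt_succ_iff_lt_or_eq.1 hr with hr | rfl
      · exact hs.current r hr htr
      · exact hs.not_updated _ hd.1
    · rw [hround, hupd]
      intro r hr htr
      rcases Nat.lt_succ_iff_lt_or_eq.1 hr with hr | rfl
      · obtain ⟨h1, h2⟩ := hs.next r hr htr
        have : worker r ≠ worker q := fun heq => hd.1 (heq ▸ h1)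
        exact ⟨Finset.mem_insert_of_mem h1, by rw [h2, hm, Function.update_of_ne this]⟩
      · omega

/-- If none of the first iterates is an `ε`-stationary point, then every round decreases the
expected objective by a fixed amount. -/
theorem Sampling.round_mul_le (h : Sampling F D μ ξ L σ thr) (hε : 0 < ε)
    (hσ : σ ^ 2 / (n * ε) ≤ thr) (hγ : γ = 1 / (10 * n * L)) {c : ℝ}
    (hc : ∀ x, c ≤ objective F D x) {Q : ℕ}
    (hbig : ∀ s ≤ Q,
      ε < ∫ ω, ‖gradient (objective F D) (iterate F ξ γ thr x₀ worker s ω)‖ ^ 2 ∂μ) :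
    (schedule thr worker Q).round * (39 / 1000 * ε / L) ≤ objective F D x₀ - c := by
  have key : ∀ q ≤ Q, ∃ z y e P, RoundState F D μ ξ γ thr ε x₀ worker q z y e P ∧
      potential F D L μ z y ≤
        objective F D x₀ - (schedule thr worker q).round * (39 / 1000 * ε / L) := by
    intro q
    induction q with
    | zero =>
      intro _
      refine ⟨fun _ => x₀, fun _ _ => x₀, fun _ _ => 0, fun _ => ∅,
        ⟨⟨0, le_rfl, rfl⟩, SqIntegrable.const x₀, fun _ => SqIntegrable.const x₀, ?_, ?_,
          fun _ _ => rfl, ?_, fun r hr => absurd hr (Nat.not_lt_zero r),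
          fun r hr => absurd hr (Nat.not_lt_zero r)⟩, ?_⟩
      · simp [schedule]
      · ext1 ω
        simp [schedule, iterate, run, State.init]
      · simp [schedule]
      -- All workers start at `x₀`, so the initial drift is zero.
      · simp [potential, schedule]
    | succ q ih =>
      intro hq
      obtain ⟨z, y, e, P, hs, hpot⟩ := ih (Nat.le_of_succ_le hq)
      exact hs.potential_succ h hε hσ hγ hc
        (fun s hsq => hbig s (hsq.trans (Nat.le_of_succ_le hq))) hpot
  obtain ⟨z, y, e, P, hs, hpot⟩ := key Q le_rfl
  have hle := h.sampleSigma_le (pastLabels thr worker (schedule thr worker Q).round)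
  have hz := (hs.sq_z.mono hle).memLp
  have hL := h.L_pos
  have hint : Integrable (fun ω => objective F D (z ω) +
      L / (20 * n) * ∑ i, ‖z ω - y i ω‖ ^ 2) μ :=
    (integrable_comp_of_smooth h.smooth.differentiable_objective
      (h.smooth.lipschitz_objective h.pos h.L_pos) hc hz).add
      ((integrable_finsetSum _ fun i _ => integrable_norm_sq_of_memLp
        (hz.sub ((hs.sq_y i).mono hle).memLp)).const_mul _)
  have hlow : c ≤ potential F D L μ z y := by
    have := integral_mono (integrable_const c) hint fun ω => by
      have h1 : 0 ≤ L / (20 * n) * ∑ i, ‖z ω - y i ω‖ ^ 2 := by positivity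
      have h2 := hc (z ω)
      show c ≤ _
      linarith
    simpa [potential] using this
  linarith

end

end Ringleader

end

/-! ### Conclusion: too many rounds for the available descent -/

open MeasureTheory ProbabilityTheory in
theorem mainTheorem3 {d n : ℕ} (hn : 0 < n)
    {Ξ : Fin n → Type*} [∀ i, MeasurableSpace (Ξ i)]
    (F : ∀ i, Ringleader.Vec d → Ξ i → ℝ)
    (D : ∀ i, Measure (Ξ i)) [∀ i, IsProbabilityMeasure (D i)]
    (σ L ε fstar : ℝ) (hL : 0 < L) (hε : 0 < ε)
    (hstoch : Ringleader.UnbiasedBoundedVariance F D σ)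
    (hsmooth : Ringleader.GeneralizedSmooth F D L)
    (hlower : ∀ x, fstar ≤ Ringleader.objective F D x)
    (x₀ : Ringleader.Vec d)
    (p : Fin n → ℝ → ℝ) (hp : ∀ i, Ringleader.IsComputePower (p i))
    (A : Ringleader.Arrivals p)
    {Ω : Type*} [MeasurableSpace Ω] (μ : Measure Ω) [IsProbabilityMeasure μ]
    (ξ : ∀ i, ℕ → Ω → Ξ i)
    (hξ_meas : ∀ i m, Measurable (ξ i m))
    (hξ_law : ∀ i m, μ.map (ξ i m) = D i)
    (hξ_indep : iIndepFun (fun (a : Fin n × ℕ) => ξ a.1 a.2) μ)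
    (K : ℕ) (hK : K = ⌈160 * L * (Ringleader.objective F D x₀ - fstar) / ε⌉₊)
    (T : ℕ → ℝ) (hT : Ringleader.IsTimeSequence p σ ε K T) :
    ∃ q : ℕ, (∀ r < q, A.time r ≤ ENNReal.ofReal (T K)) ∧
      Ringleader.IsStationaryPoint μ (Ringleader.objective F D) ε
        (fun ω => (Ringleader.run F (1 / (10 * n * L)) (Ringleader.threshold n σ ε) x₀
          (fun i m => ξ i m ω) A.worker q).x) := by
  have hS : Ringleader.Sampling F D μ ξ L σ (Ringleader.threshold n σ ε) :=
    ⟨hn, hL, Ringleader.threshold_pos n σ ε, hstoch, hsmooth, hξ_meas, hξ_law, hξ_indep⟩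
  have hlip := hsmooth.lipschitz_objective hn hL
  obtain ⟨Q, hQ, hround⟩ := Ringleader.exists_index_round hn hp A hT
  by_contra! hcon
  have hbig : ∀ s ≤ Q, ε < ∫ ω, ‖gradient (Ringleader.objective F D)
      (Ringleader.iterate F ξ (1 / (10 * n * L)) (Ringleader.threshold n σ ε) x₀ A.worker s ω)‖ ^ 2
      ∂μ := by
    intro s hs
    by_contra! hle
    refine hcon s (fun r hr => hQ r (hr.trans_le hs)) ?_
    have hX := (hS.sqIntegrable_iterate (1 / (10 * n * L)) x₀ A.worker s).1.mono
      (hS.sampleSigma_le _)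
    exact ⟨hX.measurable,
      Ringleader.integrable_norm_sq_of_memLp (hX.comp_lipschitz hlip).memLp, hle⟩
  -- From here on the contradiction is arithmetic: the number of rounds is at least `K / 2`, while
  -- their total cost is at most `Δ`.
  have hmain := hS.round_mul_le hε (le_max_right _ _) rfl hlower hbig
  have h0 : ε < ‖gradient (Ringleader.objective F D) x₀‖ ^ 2 := by
    have := hbig 0 (Nat.zero_le Q)
    simpa [Ringleader.iterate, Ringleader.run, Ringleader.State.init] using this
  have h1 := Ringleader.norm_gradient_sq_le hsmooth.differentiable_objective hL hlip hlower x₀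
  set Δ := Ringleader.objective F D x₀ - fstar
  have hΔ : ε < 2 * L * Δ := h0.trans_le h1
  have hKle : 160 * L * Δ / ε ≤ K := hK ▸ Nat.le_ceil _
  rw [div_le_iff₀ hε] at hKle
  -- The rounding in `K / 2` costs at most a factor `3` instead of `2` once `K ≥ 2`. This holds
  -- because `x₀` is not stationary, so `ε < 2 L Δ`, whereas `K ≤ 1` would give `160 L Δ ≤ ε`.
  have hK2 : (K : ℝ) ≤ 3 * (K / 2 : ℕ) := by
    have hK3 : 1 < K := by
      by_contra! hK1
      have : (K : ℝ) ≤ 1 := by exact_mod_cast hK1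
      nlinarith
    exact_mod_cast (by omega : K ≤ 3 * (K / 2))
  have hround' : ((K / 2 : ℕ) : ℝ) ≤
      ((Ringleader.schedule (Ringleader.threshold n σ ε) A.worker Q).round : ℝ) := by
    exact_mod_cast hround
  have h2 := mul_le_mul_of_nonneg_right (hK2.trans (mul_le_mul_of_nonneg_left hround' three_pos.le))
    (by positivity : 0 ≤ 39 / 1000 * ε / L)
  have h3 : (K : ℝ) * (39 / 1000 * ε / L) ≤ 3 * Δ := by linarith
  rw [mul_div_assoc', div_le_iff₀ hL] at h3
  -- `160 · 39/1000 = 6.24` exceeds `3`, and `L Δ` is positive.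
  nlinarith
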